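/- Boolean formulas are built from the constants True and False and variables $x_0,x_1,x_2,\dots$ with $\neg,\wedge,\vee$, and are written as strings over a finite alphabet, with variable indices in binary. For a formula $F$ in which exactly $k$ distinct variables occur, let $\#\mathrm{SAT}(F)$ be the number of those of the $2^k$ assignments of truth values to these variables under which $F$ evaluates to True. A *polynomial-time $2$-enumerator* for $\#\mathrm{SAT}$ is a function $h$, computable in polynomial time, that maps every formula $F$ to a list of two (perhaps identical) natural numbers, written in binary, such that $\#\mathrm{SAT}(F)$ appears in the list $h(F)$. **Theorem (Cai and Hemachandra).** If $\#\mathrm{SAT}$ has a polynomial-time $2$-enumerator, then $\#\mathrm{SAT}$ is computable in polynomial time: there is a Turing machine that, given a formula $F$, outputs the binary representation of $\#\mathrm{SAT}(F)$ within a number of steps that is polynomial in the length of $F$. -/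

import Mathlib

/-- Boolean formulas over the variables `x₀, x₁, x₂, …`, built from the constants `True` and `False`
and the variables with `¬`, `∧` and `∨`. -/
inductive BoolFormula : Type
  | const (b : Bool)
  | var (i : ℕ)
  | neg (F : BoolFormula)
  | conj (F G : BoolFormula)
  | disj (F G : BoolFormula)

namespace BoolFormula

/-- The truth value of a formula under an assignment of truth values to the variables. -/
def eval (v : ℕ → Bool) : BoolFormula → Bool
  | const b => b
  | var i => v i
  | neg F => !(F.eval v)
  | conj F G => F.eval v && G.eval v
  | disj F G => F.eval v || G.eval v

/-- The set of (indices of) the variables that occur in a formula. -/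
def vars : BoolFormula → Finset ℕ
  | const _ => ∅
  | var i => {i}
  | neg F => F.vars
  | conj F G => F.vars ∪ G.vars
  | disj F G => F.vars ∪ G.vars

/-- The truth value of `F` under an assignment `a` to the variables that occur in `F`
(the value `false` given to the variables that do not occur in `F` has no influence). -/
def evalOn (F : BoolFormula) (a : F.vars → Bool) : Bool :=
  F.eval fun i => if hi : i ∈ F.vars then a ⟨i, hi⟩ else false

/-- The function `#SAT`: of the `2 ^ k` assignments to the `k` variables that occur in `F`, the
number of those under which `F` is true. -/
def sharpSAT (F : BoolFormula) : ℕ :=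
  Fintype.card {a : F.vars → Bool // F.evalOn a = true}

/-- The finite alphabet in which formulas are written. -/
inductive Symb : Type
  | const (b : Bool)
  | neg
  | conj
  | disj
  | varOpen
  | bit (b : Bool)
  | varClose
  deriving DecidableEq, Fintype

/-- A formula as a string: prefix (Polish) notation, where the variable `xᵢ` is written as the
binary numeral of `i` (least significant bit first) between two delimiters. -/
def encode : BoolFormula → List Symb
  | const b => [Symb.const b]
  | var i => Symb.varOpen :: (Computability.encodeNat i).map Symb.bit ++ [Symb.varClose]
  | neg F => Symb.neg :: F.encode
  | conj F G => Symb.conj :: (F.encode ++ G.encode)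
  | disj F G => Symb.disj :: (F.encode ++ G.encode)

theorem bits_append_inj {l l' : List Bool} {s s' : List Symb}
    (h : l.map Symb.bit ++ Symb.varClose :: s = l'.map Symb.bit ++ Symb.varClose :: s') :
    l = l' ∧ s = s' := by
  induction l generalizing l' with
  | nil => cases l' <;> simp_all
  | cons b l ih =>
    cases l' with
    | nil => simp at h
    | cons b' l' =>
      simp only [List.map_cons, List.cons_append, List.cons.injEq, Symb.bit.injEq] at h
      obtain ⟨rfl, h⟩ := h
      obtain ⟨rfl, rfl⟩ := ih h
      exact ⟨rfl, rfl⟩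

theorem encode_append_inj (F G : BoolFormula) (s t : List Symb)
    (h : F.encode ++ s = G.encode ++ t) : F = G ∧ s = t := by
  induction F generalizing G s t with
  | const b => cases G <;> simp_all [encode]
  | var i =>
    cases G with
    | var j =>
      simp only [encode, List.cons_append, List.append_assoc, List.nil_append,
        List.cons.injEq, true_and] at h
      obtain ⟨hb, hs⟩ := bits_append_inj h
      exact ⟨congrArg var (Computability.encodingNatBool.encode_injective hb), hs⟩
    | _ => simp [encode] at h
  | neg F ih =>
    cases G with
    | neg G =>
      simp only [encode, List.cons_append, List.cons.injEq, true_and] at h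
      obtain ⟨rfl, rfl⟩ := ih _ _ _ h
      exact ⟨rfl, rfl⟩
    | _ => simp [encode] at h
  | conj F F' ih ih' =>
    cases G with
    | conj G G' =>
      simp only [encode, List.cons_append, List.append_assoc, List.cons.injEq, true_and] at h
      obtain ⟨rfl, hs⟩ := ih _ _ _ h
      obtain ⟨rfl, rfl⟩ := ih' _ _ _ hs
      exact ⟨rfl, rfl⟩
    | _ => simp [encode] at h
  | disj F F' ih ih' =>
    cases G with
    | disj G G' =>
      simp only [encode, List.cons_append, List.append_assoc, List.cons.injEq, true_and] at h
      obtain ⟨rfl, hs⟩ := ih _ _ _ h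
      obtain ⟨rfl, rfl⟩ := ih' _ _ _ hs
      exact ⟨rfl, rfl⟩
    | _ => simp [encode] at h

/-- Different formulas are different strings. -/
theorem encode_injective : Function.Injective encode := fun F G h =>
  (encode_append_inj F G [] [] (by rw [h])).1

end BoolFormula

/-- Pairs of natural numbers as strings: two binary numerals, one after the other, whose bits are
marked as belonging to the first or to the second number. -/
def encodeNatPair : ℕ × ℕ → List (Bool ⊕ Bool) :=
  (Computability.encodingProd Computability.encodingNatBool Computability.encodingNatBool).encode

/-- `f` is computable in polynomial time: some (multi-stack) Turing machine turns the string `ea x` into the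
string `eb (f x)`, for every `x`, in a number of steps that is at most a polynomial in the length
of `ea x`. -/
def PolyTimeComputable {α β Γ Δ : Type} (ea : α → List Γ) (eb : β → List Δ) (f : α → β) : Prop :=
  Nonempty (Turing.TM2ComputableInPolyTime ea eb f)

/-- `h` is a polynomial-time `2`-enumerator for `#SAT`: it is computable in polynomial time, and on
each formula it outputs two (perhaps identical) natural numbers, one of which is the number of
satisfying assignments. -/
def IsPolyTimeTwoEnumerator (h : BoolFormula → ℕ × ℕ) : Prop :=
  PolyTimeComputable BoolFormula.encode encodeNatPair h ∧
    ∀ F : BoolFormula, F.sharpSAT = (h F).1 ∨ F.sharpSAT = (h F).2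

/-! Write `N` for the number of satisfying assignments of `F`. The enumerator `h`, applied to `F`,
gives two candidates for `N`, and it remains to decide between them. The search keeps a formula `G`,
an instance of `F`, together with numbers `a`, `s`, `t` such that `N = s` if `G` has exactly `a`
satisfying assignments and `N = t` otherwise.

To remove a variable `x` of `G`, let `G₀`, `G₁` be its two instances and `n` the length of `F`. The
enumerator is asked about `G ∧ (x ∨ Y)`, where `Y` is a conjunction of `n` new variables. If `x` is
true, the new variables are free; if `x` is false, they are all forced to be true. So the count is
`#G₀ + 2 ^ n * #G₁` (`sharpSAT_combine`). Both counts are below `2 ^ n`, hence each of the two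
answers splits into a conjectured pair for `(#G₀, #G₁)`, one of which is right. The sum of each pair
predicts whether `#G = a`. If the predictions agree, `N` is known. Otherwise the pairs differ in
some component, and the instance that belongs to it becomes the new `G`: its count tells which pair
is right (`claims_narrow`). After `n` steps no variable is left, and evaluation of `G` settles the
question (`searchState_spec`, `searchResult_eq`).

For the running time, polynomial-time functions on tuples of strings are shown to be closed under
composition (`PolyTime.comp`), case distinction (`PolyTime.popCases`) and iteration along a string
with intermediate results of polynomial length (`PolyTime.foldl`). The operations on formulas and
numerals are such iterations; a formula is read from right to left, which suits prefix notation.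
`size_searchState_le` bounds the states of the search. `polyTime_of_tm` and
`polyTimeComputable_of_polyTime` pass from Turing machines to this calculus and back. -/

open Turing

noncomputable section

namespace StackMachine

/-! ### Runs of transition systems -/

/-- `StepsIn f c n d`: the transition function `f` leads from `c` to `d` in exactly `n` steps. -/
inductive StepsIn {C : Type} (f : C → Option C) : C → ℕ → C → Prop
  | refl (c : C) : StepsIn f c 0 c
  | head {c d e : C} {n : ℕ} : f c = some d → StepsIn f d n e → StepsIn f c (n + 1) e

namespace StepsIn

variable {C D : Type} {f : C → Option C} {g : D → Option D}

theorem trans {c d e : C} {m n : ℕ} (h : StepsIn f c m d) (h' : StepsIn f d n e) :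
    StepsIn f c (m + n) e := by
  induction h with
  | refl => simpa using h'
  | head h₁ _ ih => rw [Nat.add_right_comm]; exact .head h₁ (ih h')

theorem simulate {R : C → D → Prop}
    (hR : ∀ c c' d, R c d → f c = some c' → ∃ d', g d = some d' ∧ R c' d')
    {c c' : C} {n : ℕ} (h : StepsIn f c n c') {d : D} (hd : R c d) :
    ∃ d', StepsIn g d n d' ∧ R c' d' := by
  induction h generalizing d with
  | refl => exact ⟨d, .refl d, hd⟩
  | head h₁ _ ih =>
    obtain ⟨d₁, hd₁, hr⟩ := hR _ _ _ hd h₁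
    obtain ⟨d₂, hd₂, hr'⟩ := ih hr
    exact ⟨d₂, .head hd₁ hd₂, hr'⟩

/-- The iterate is the form in which the output condition of `TM2ComputableInPolyTime` counts steps.
-/
theorem iff_iterate {c d : C} {n : ℕ} : StepsIn f c n d ↔ (flip bind f)^[n] (some c) = some d := by
  constructor
  · intro h
    induction h with
    | refl => rfl
    | @head c d' e m h₁ _ ih =>
      have h₂ : flip bind f (some c) = some d' := h₁
      rw [Function.iterate_succ_apply, h₂, ih]
  · induction n generalizing c with
    | zero => intro h; cases h; exact .refl _
    | succ n ih =>
      intro h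
      rw [Function.iterate_succ_apply] at h
      have h₂ : flip bind f (some c) = f c := rfl
      rw [h₂] at h
      cases hc : f c with
      | none =>
        rw [hc] at h
        have : ∀ m, (flip bind f)^[m] none = none := fun m => by
          induction m with
          | zero => rfl
          | succ m ih => rw [Function.iterate_succ_apply]; exact ih
        rw [this] at h
        cases h
      | some c' => exact .head hc (ih (by rw [← h, hc]))

end StepsIn

/-! ### Translating statements from one machine into another -/

/-- A way to place a family of stacks inside another one. -/
structure StackEmbedding {K K' : Type} (Γ : K → Type) (Γ' : K' → Type) where
  stk : K → K'
  inj : Function.Injective stk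
  write : ∀ k, Γ k → Γ' (stk k)
  read : ∀ k, Γ' (stk k) → Option (Γ k)
  read_write : ∀ k x, read k (write k x) = some x

namespace StackEmbedding

variable {K K' : Type} {Γ : K → Type} {Γ' : K' → Type}

/-- A placement of stacks that all have the same alphabet. -/
def ofInj (A : Type) (e : K → K') (he : Function.Injective e) :
    StackEmbedding (fun _ : K => A) (fun _ : K' => A) :=
  ⟨e, he, fun _ => id, fun _ => some, fun _ _ => rfl⟩

/-- The identical placement. -/
def refl (Γ : K → Type) : StackEmbedding Γ Γ :=
  ⟨id, Function.injective_id, fun _ => id, fun _ => some, fun _ _ => rfl⟩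

/-- The store `S'` contains the store `S` and agrees with `T` on all the other stacks. -/
def Rel (E : StackEmbedding Γ Γ') (T : ∀ k, List (Γ' k)) (S : ∀ k, List (Γ k))
    (S' : ∀ k, List (Γ' k)) : Prop :=
  (∀ k, S' (E.stk k) = (S k).map (E.write k)) ∧ ∀ j, (∀ k, E.stk k ≠ j) → S' j = T j

/-- Identifies the store reached by a simulation with the one prescribed in advance. -/
theorem Rel.eq {E : StackEmbedding Γ Γ'} {T : ∀ k, List (Γ' k)} {S : ∀ k, List (Γ k)}
    {S₁ S₂ : ∀ k, List (Γ' k)} (h₁ : E.Rel T S S₁) (h₂ : E.Rel T S S₂) : S₁ = S₂ := by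
  funext j
  by_cases hj : ∃ k, E.stk k = j
  · obtain ⟨k, rfl⟩ := hj
    rw [h₁.1, h₂.1]
  · have hj' : ∀ k, E.stk k ≠ j := fun k hk => hj ⟨k, hk⟩
    rw [h₁.2 j hj', h₂.2 j hj']

theorem rel_refl (S T : ∀ k, List (Γ k)) : (StackEmbedding.refl Γ).Rel T S S :=
  ⟨fun k => (List.map_id (S k)).symm, fun j hj => absurd rfl (hj j)⟩

theorem Rel.update [DecidableEq K] [DecidableEq K'] {E : StackEmbedding Γ Γ'} {T : ∀ k, List (Γ' k)} {S : ∀ k, List (Γ k)}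
    {S' : ∀ k, List (Γ' k)} (h : E.Rel T S S') (k : K) (l : List (Γ k)) :
    E.Rel T (Function.update S k l) (Function.update S' (E.stk k) (l.map (E.write k))) := by
  refine ⟨fun k' => ?_, fun j hj => ?_⟩
  · by_cases hk : k' = k
    · subst hk; simp
    · rw [Function.update_of_ne (fun h' => hk (E.inj h')), Function.update_of_ne hk, h.1]
  · rw [Function.update_of_ne (hj k).symm, h.2 j hj]

section Stmt

variable {Λ Λ' σ σ' : Type} (E : StackEmbedding Γ Γ') (lab : Λ → Λ') (get : σ' → σ)
  (set : σ → σ') (next : Option Λ') (fin : σ')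

/-- The translation of a statement: the stacks are placed by `E`, the labels are renamed by `lab`,
the internal state is accessed by `get` and `set`, and halting is replaced by a jump to `next`
in the state `fin`. -/
def mapStmt : TM2.Stmt Γ Λ σ → TM2.Stmt Γ' Λ' σ'
  | .push k f q => .push (E.stk k) (fun v => E.write k (f (get v))) (mapStmt q)
  | .peek k f q =>
    .peek (E.stk k) (fun v o => set (f (get v) (o.bind (E.read k)))) (mapStmt q)
  | .pop k f q => .pop (E.stk k) (fun v o => set (f (get v) (o.bind (E.read k)))) (mapStmt q)
  | .load a q => .load (fun v => set (a (get v))) (mapStmt q)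
  | .branch p q r => .branch (fun v => p (get v)) (mapStmt q) (mapStmt r)
  | .goto l => .goto (fun v => lab (l (get v)))
  | .halt => .load (fun _ => fin)
    (match next with
      | some l => .goto (fun _ => l)
      | none => .halt)

/-- The relation between the configurations of a machine and those of its translation. -/
def CfgRel (T : ∀ k, List (Γ' k)) (c : TM2.Cfg Γ Λ σ) (c' : TM2.Cfg Γ' Λ' σ') : Prop :=
  E.Rel T c.stk c'.stk ∧
    (∀ l, c.l = some l → c'.l = some (lab l) ∧ c'.var = set c.var) ∧
    (c.l = none → c'.l = next ∧ c'.var = fin)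

variable {E get set}

theorem head_bind_read {S : ∀ k, List (Γ k)} {S' T : ∀ k, List (Γ' k)} (h : E.Rel T S S') (k : K) :
    (S' (E.stk k)).head?.bind (E.read k) = (S k).head? := by
  rw [h.1]
  cases S k with
  | nil => rfl
  | cons x l => simp [E.read_write]

/-- Leaving the program is part of the same statement in which the original halts, so one step
corresponds to exactly one step. -/
theorem stepAux_mapStmt [DecidableEq K] [DecidableEq K'] (hgs : ∀ v, get (set v) = v) {T : ∀ k, List (Γ' k)}
    (q : TM2.Stmt Γ Λ σ) (v : σ) {S : ∀ k, List (Γ k)} {S' : ∀ k, List (Γ' k)}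
    (h : E.Rel T S S') :
    E.CfgRel lab set next fin T (TM2.stepAux q v S)
      (TM2.stepAux (E.mapStmt lab get set next fin q) (set v) S') := by
  induction q generalizing v S S' with
  | push k f q ih =>
    have h' := h.update k (f v :: S k)
    rw [List.map_cons, ← h.1 k] at h'
    simpa [mapStmt, hgs] using ih v h'
  | peek k f q ih =>
    simpa [mapStmt, hgs, head_bind_read h] using ih (f v (S k).head?) h
  | pop k f q ih =>
    have h' := h.update k (S k).tail
    rw [List.map_tail, ← h.1 k] at h'
    simpa [mapStmt, hgs, head_bind_read h] using ih (f v (S k).head?) h'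
  | load a q ih => simpa [mapStmt, hgs] using ih (a v) h
  | branch p q r ih₁ ih₂ =>
    simp only [mapStmt, TM2.stepAux, hgs]
    cases p v
    · exact ih₂ v h
    · exact ih₁ v h
  | goto l => simp [mapStmt, CfgRel, hgs, h]
  | halt => cases next <;> simp [mapStmt, CfgRel, h]

end Stmt

end StackEmbedding

/-! ### Programs -/

/-- A program for a multi-stack machine with the stacks `K`. -/
structure Prog {K : Type} (Γ : K → Type) where
  Λ : Type
  [finΛ : Fintype Λ]
  σ : Type
  [finσ : Fintype σ]
  main : Λ
  start : σ
  m : Λ → TM2.Stmt Γ Λ σ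

attribute [instance] Prog.finΛ Prog.finσ

namespace Prog

variable {K K' : Type} [DecidableEq K] [DecidableEq K'] {Γ : K → Type} {Γ' : K' → Type}

/-- The program `P` transforms the store `S` into the store `S'` in at most `n` steps. -/
def Runs (P : Prog Γ) (S : ∀ k, List (Γ k)) (n : ℕ) (S' : ∀ k, List (Γ k)) : Prop :=
  -- The final state is again the start state: this makes programs repeatable, and it is what
  -- `haltList` prescribes.
  ∃ t ≤ n, StepsIn (TM2.step P.m) ⟨some P.main, P.start, S⟩ t ⟨none, P.start, S'⟩

theorem Runs.mono {P : Prog Γ} {S S' : ∀ k, List (Γ k)} {m n : ℕ} (h : P.Runs S m S')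
    (hmn : m ≤ n) : P.Runs S n S' := by
  obtain ⟨t, ht, h⟩ := h
  exact ⟨t, ht.trans hmn, h⟩

/-- Common source of the rules for `embed`, `seq` and `dispatch`: inside any machine that contains
the translated statements, the program runs from its entry to the exit `next` without extra steps.
-/
theorem Runs.translate {P : Prog Γ} {E : StackEmbedding Γ Γ'} {Λ' σ' : Type} {lab : P.Λ → Λ'}
    {get : σ' → P.σ} {set : P.σ → σ'} {next : Option Λ'} {fin : σ'} {M : Λ' → TM2.Stmt Γ' Λ' σ'}
    (hM : ∀ l, M (lab l) = E.mapStmt lab get set next fin (P.m l)) (hgs : ∀ v, get (set v) = v)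
    {S S' : ∀ k, List (Γ k)} {T T' : ∀ k, List (Γ' k)} {n : ℕ} (h : P.Runs S n S')
    (hT : E.Rel T S T) (hT' : E.Rel T S' T') :
    ∃ t ≤ n, StepsIn (TM2.step M) ⟨some (lab P.main), set P.start, T⟩ t ⟨next, fin, T'⟩ := by
  obtain ⟨t, ht, h⟩ := h
  have hR : ∀ c c' d, E.CfgRel lab set next fin T c d → TM2.step P.m c = some c' →
      ∃ d', TM2.step M d = some d' ∧ E.CfgRel lab set next fin T c' d' := by
    rintro ⟨l, v, U⟩ c ⟨l', v', U'⟩ hc hstep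
    cases l with
    | none => simp at hstep
    | some l =>
      obtain ⟨hl, hv⟩ := hc.2.1 l rfl
      simp only at hl hv
      subst hl hv
      simp only [TM2.step, Option.some.injEq] at hstep
      subst hstep
      refine ⟨_, rfl, ?_⟩
      rw [hM]
      exact StackEmbedding.stepAux_mapStmt lab next fin hgs (P.m l) v hc.1
  obtain ⟨⟨l, v, U⟩, h₁, h₂⟩ := h.simulate hR
    (d := ⟨some (lab P.main), set P.start, T⟩) ⟨hT, by simp, by simp⟩
  obtain ⟨rfl, rfl⟩ := h₂.2.2 rfl
  obtain rfl := hT'.eq h₂.1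
  exact ⟨t, ht, h₁⟩

/-- The program `P`, run on the stacks where `E` places its stacks. -/
def embed (P : Prog Γ) (E : StackEmbedding Γ Γ') : Prog Γ' where
  Λ := P.Λ
  σ := P.σ
  main := P.main
  start := P.start
  m l := E.mapStmt id id id none P.start (P.m l)

theorem Runs.embed {P : Prog Γ} {E : StackEmbedding Γ Γ'} {S S' : ∀ k, List (Γ k)}
    {T T' : ∀ k, List (Γ' k)} {n : ℕ} (h : P.Runs S n S')
    (hT : ∀ k, T (E.stk k) = (S k).map (E.write k))
    (hT' : ∀ k, T' (E.stk k) = (S' k).map (E.write k))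
    (hTT' : ∀ j, T' j = T j ∨ ∃ k, E.stk k = j) : (P.embed E).Runs T n T' :=
  h.translate (P := P) (M := (P.embed E).m) (fun _ => rfl) (fun _ => rfl)
    (hT := ⟨hT, fun _ _ => rfl⟩)
    (hT' := ⟨hT', fun j hj => (hTT' j).resolve_right fun ⟨k, hk⟩ => hj k hk⟩)

/-- The program that does nothing. -/
def skip (Γ : K → Type) : Prog Γ where
  Λ := Unit
  σ := Unit
  main := ()
  start := ()
  m _ := .halt

theorem runs_skip (S : ∀ k, List (Γ k)) : (skip Γ).Runs S 1 S :=
  ⟨1, le_rfl, .head rfl (.refl _)⟩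

/-- Push letters onto stacks, the last one of the list first. -/
def pushes (L : List (Σ k, Γ k)) : Prog Γ where
  Λ := Unit
  σ := Unit
  main := ()
  start := ()
  m _ := L.foldr (fun p q => .push p.1 (fun _ => p.2) q) .halt

/-- The store that results from pushing letters onto stacks. -/
def pushAll (L : List (Σ k, Γ k)) (S : ∀ k, List (Γ k)) : ∀ k, List (Γ k) :=
  L.foldl (fun S p => Function.update S p.1 (p.2 :: S p.1)) S

theorem runs_pushes (L : List (Σ k, Γ k)) (S : ∀ k, List (Γ k)) :
    (pushes L).Runs S 1 (pushAll L S) := by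
  refine ⟨1, le_rfl, .head ?_ (.refl _)⟩
  simp only [TM2.step, Option.some.injEq]
  change TM2.stepAux (L.foldr (fun p q => TM2.Stmt.push p.1 (fun _ => p.2) q) .halt) () S = _
  induction L generalizing S with
  | nil => rfl
  | cons p L ih => exact ih _

/-- Run `P`, then run `Q`. -/
def seq (P Q : Prog Γ) : Prog Γ where
  Λ := P.Λ ⊕ Q.Λ
  σ := P.σ ⊕ Q.σ
  main := .inl P.main
  start := .inl P.start
  m
    | .inl l => (StackEmbedding.refl Γ).mapStmt .inl (Sum.elim id fun _ => P.start) .inl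
        (some (.inr Q.main)) (.inr Q.start) (P.m l)
    -- Halting resets the state to the start of `P`, which is the start state of the composite.
    | .inr l => (StackEmbedding.refl Γ).mapStmt .inr (Sum.elim (fun _ => Q.start) id) .inr
        none (.inl P.start) (Q.m l)

theorem Runs.seq {P Q : Prog Γ} {S S' S'' : ∀ k, List (Γ k)} {m n : ℕ} (h : P.Runs S m S')
    (h' : Q.Runs S' n S'') : (P.seq Q).Runs S (m + n) S'' := by
  obtain ⟨t, ht, h₁⟩ := h.translate (M := (P.seq Q).m) (lab := .inl) (set := .inl)
    (get := Sum.elim id fun _ => P.start) (fun _ => rfl) (fun _ => rfl)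
    (hT := StackEmbedding.rel_refl S S) (hT' := StackEmbedding.rel_refl S' S)
  obtain ⟨t', ht', h₂⟩ := h'.translate (M := (P.seq Q).m) (lab := .inr) (set := .inr)
    (get := Sum.elim (fun _ => Q.start) id) (fun _ => rfl) (fun _ => rfl)
    (hT := StackEmbedding.rel_refl S' S') (hT' := StackEmbedding.rel_refl S'' S')
  exact ⟨t + t', by omega, h₁.trans h₂⟩

/-- Pop a letter from the stack `k`, run the program that belongs to it (or to the fact that there
was none), and repeat this if the letter says so. -/
def dispatch {T : Type} [Fintype T] (k : K) (dec : Γ k → Option T) (P : Option T → Prog Γ)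
    (again : Option T → Bool) : Prog Γ where
  Λ := Option (Σ o, (P o).Λ)
  σ := Option (Σ o, (P o).σ)
  main := none
  start := none
  m
    | none => .pop k (fun _ o => some ⟨o.bind dec, (P (o.bind dec)).start⟩)
        (.goto fun v => v.map fun p => ⟨p.1, (P p.1).main⟩)
    | some ⟨o, l⟩ => (StackEmbedding.refl Γ).mapStmt (fun l => some ⟨o, l⟩)
        -- The state records which program is running; the default covers states of other programs,
        -- which do not arise while this one runs.
        (fun v => v.elim (P o).start fun p =>
          open Classical in if h : p.1 = o then h ▸ p.2 else (P o).start)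
        (fun v => some ⟨o, v⟩)
        (if again o then some none else none) none ((P o).m l)

section dispatch

variable {T : Type} [Fintype T] {k : K} {dec : Γ k → Option T} {P : Option T → Prog Γ}
  {again : Option T → Bool} {S S' S'' : ∀ k, List (Γ k)} {n n' : ℕ}

theorem dispatch_aux {o : Option T} (ho : (S k).head?.bind dec = o)
    (h : (P o).Runs (Function.update S k (S k).tail) n S') :
    ∃ t ≤ n + 1, StepsIn (TM2.step (dispatch k dec P again).m) ⟨some none, none, S⟩ t
      ⟨if again o then some none else none, none, S'⟩ := by
  obtain ⟨t, ht, h₁⟩ := h.translate (M := (dispatch k dec P again).m)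
    (lab := fun l => some ⟨o, l⟩) (set := fun v => some ⟨o, v⟩) (fun _ => rfl)
    (fun _ => by simp) (hT := StackEmbedding.rel_refl _ _) (hT' := StackEmbedding.rel_refl S' _)
  subst ho
  exact ⟨t + 1, by omega, .head rfl h₁⟩

theorem runs_dispatch {o : Option T} (ho : (S k).head?.bind dec = o)
    (h : (P o).Runs (Function.update S k (S k).tail) n S') (ha : again o = false) :
    (dispatch k dec P again).Runs S (n + 1) S' := by
  obtain ⟨t, ht, h₁⟩ := dispatch_aux (again := again) ho h
  rw [ha] at h₁
  exact ⟨t, ht, h₁⟩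

theorem runs_dispatch_again {o : Option T} (ho : (S k).head?.bind dec = o)
    (h : (P o).Runs (Function.update S k (S k).tail) n S') (ha : again o = true)
    (h' : (dispatch k dec P again).Runs S' n' S'') :
    (dispatch k dec P again).Runs S (n + 1 + n') S'' := by
  obtain ⟨t, ht, h₁⟩ := dispatch_aux (again := again) ho h
  obtain ⟨t', ht', h₂⟩ := h'
  rw [ha] at h₁
  exact ⟨t + t', by omega, h₁.trans h₂⟩

end dispatch

/-- Run `P x` for each letter `x` of the stack `k`. -/
def forEach {T : Type} [Fintype T] (k : K) (dec : Γ k → Option T) (P : T → Prog Γ) : Prog Γ :=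
  dispatch k dec (fun o => o.elim (skip Γ) P) Option.isSome

/-- `S` is the loop invariant: `S l'` is the store when the letters `l'` are still to be treated.
The final `2` pays for the pop from the empty stack and for `skip`. -/
theorem runs_forEach {T : Type} [Fintype T] {k : K} {dec : Γ k → Option T} {P : T → Prog Γ}
    {enc : T → Γ k} (hde : ∀ x, dec (enc x) = some x) (l : List T)
    (S : List T → ∀ k, List (Γ k)) (hS : ∀ l', S l' k = l'.map enc) (n : ℕ)
    (h : ∀ x l', (x :: l') <:+ l → (P x).Runs (Function.update (S (x :: l')) k (l'.map enc)) n (S l')) :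
    (forEach k dec P).Runs (S l) (l.length * (n + 1) + 2) (S []) := by
  induction l with
  | nil =>
    rw [List.length_nil, Nat.zero_mul, Nat.zero_add]
    refine runs_dispatch (o := none) (by simp [hS]) ?_ rfl
    have : Function.update (S []) k (S [] k).tail = S [] := by
      rw [Function.update_eq_self_iff, hS]
      rfl
    rw [this]
    exact runs_skip _
  | cons x l ih =>
    have h₁ := h x l (List.suffix_refl _)
    refine (runs_dispatch_again (o := some x) (n := n) (S' := S l) (by simp [hS, hde]) ?_ rfl
      (ih fun y l' hl' => h y l' (hl'.trans (List.suffix_cons x l)))).mono ?_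
    · simpa [hS] using h₁
    · rw [List.length_cons]
      linarith

/-- Move the letters of the stack `k` to the stacks in `ts`, in reversed order. -/
def transfer {T : Type} [Fintype T] (k : K) (dec : Γ k → Option T) (ts : List K)
    (w : T → ∀ j, Γ j) : Prog Γ :=
  forEach k dec fun x => pushes (ts.map fun j => ⟨j, w x j⟩)

theorem pushAll_map (ts : List K) (hts : ts.Nodup) (w : ∀ j, Γ j) (S : ∀ k, List (Γ k)) (j : K) :
    pushAll (ts.map fun j => ⟨j, w j⟩) S j = if j ∈ ts then w j :: S j else S j := by
  induction ts generalizing S with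
  | nil => rfl
  | cons t ts ih =>
    have := ih hts.of_cons (Function.update S t (w t :: S t))
    rw [List.map_cons]
    refine this.trans ?_
    by_cases hj : j = t
    · subst hj
      simp [(List.nodup_cons.1 hts).1]
    · simp [hj]

theorem runs_transfer {T : Type} [Fintype T] {k : K} {dec : Γ k → Option T} {ts : List K}
    {w : T → ∀ j, Γ j} {enc : T → Γ k} (hde : ∀ x, dec (enc x) = some x) (hts : ts.Nodup)
    (hk : k ∉ ts) {l : List T} {S S' : ∀ k, List (Γ k)} (hS : S k = l.map enc) (hS' : S' k = [])
    (hT : ∀ j ∈ ts, S' j = (l.map fun x => w x j).reverse ++ S j)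
    (hN : ∀ j ∉ ts, j ≠ k → S' j = S j) :
    (transfer k dec ts w).Runs S (2 * l.length + 2) S' := by
  -- The store when `l'` is left: the letters before `l'` have arrived at the targets.
  let U : List T → ∀ k, List (Γ k) := fun l' => Function.update
    (fun j => if j ∈ ts then ((l.take (l.length - l'.length)).map fun x => w x j).reverse ++ S j
      else S j) k (l'.map enc)
  have key := runs_forEach (P := fun x => pushes (ts.map fun j => ⟨j, w x j⟩)) hde l U
    (fun l' => by simp [U]) 1 (fun x l' hl' => by
      convert runs_pushes (ts.map fun j => ⟨j, w x j⟩) _ using 1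
      funext j
      rw [pushAll_map _ hts]
      obtain ⟨l₀, rfl⟩ := hl'
      by_cases hj : j = k
      · subst hj
        simp [U, hk]
      · have h₁ : l₀.length + (l'.length + 1) - l'.length = l₀.length + 1 := by omega
        have h₂ : l₀.length + (l'.length + 1) - (l'.length + 1) = l₀.length := by omega
        by_cases hj' : j ∈ ts
        · simp [U, hj, hj', h₁, List.take_append]
        · simp [U, hj, hj'])
  have h₁ : U l = S := by
    funext j
    by_cases hj : j = k
    · subst hj; simp [U, hS]
    · simp [U, hj]
  have h₂ : U [] = S' := by
    funext j
    by_cases hj : j = k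
    · subst hj; simp [U, hS']
    · by_cases hj' : j ∈ ts
      · simp [U, hj, hj', hT j hj']
      · simp [U, hj, hj', hN j hj' hj]
  rw [h₁, h₂] at key
  exact key.mono (by omega)

end Prog

end StackMachine

end

noncomputable section

namespace StackMachine

open BoolFormula

theorem eval_mono (p : Polynomial ℕ) {m n : ℕ} (h : m ≤ n) : p.eval m ≤ p.eval n := by
  induction p using Polynomial.induction_on' with
  | add p q hp hq => simpa using add_le_add hp hq
  | monomial k a => simpa using Nat.mul_le_mul_left a (Nat.pow_le_pow_left h k)

/-! ### Polynomial-time functions -/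

/-- The total length of a tuple of strings. -/
def len {ι : Type} [Fintype ι] (x : ι → List Symb) : ℕ := ∑ i, (x i).length

/-- The store with the input strings `x` and the output strings `y`, all other stacks being empty. -/
def ports (X : Type) {W ι κ : Type} (x : ι → List Symb) (y : κ → List Symb) :
    W ⊕ (ι ⊕ κ) → List (Symb ⊕ X) :=
  Sum.elim (fun _ => []) (Sum.elim (fun i => (x i).map .inl) fun j => (y j).map .inl)

section

variable (X : Type) {ι κ μ ν : Type} [Fintype ι] [Fintype κ] [Fintype μ] [Fintype ν]
  [DecidableEq ι] [DecidableEq κ] [DecidableEq μ] [DecidableEq ν] {α β γ δ : Type}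

/-- A machine that turns the strings `ea a` into the strings `eb (f a)` in polynomial time. It has
input stacks `ι`, output stacks `κ` and some other stacks, and its alphabet may have additional
letters `X`. -/
structure Machine (ea : α → ι → List Symb) (eb : β → κ → List Symb) (f : α → β) where
  W : Type
  [finW : Fintype W]
  [decW : DecidableEq W]
  prog : Prog fun _ : W ⊕ (ι ⊕ κ) => Symb ⊕ X
  time : Polynomial ℕ
  -- Inputs are consumed and all other stacks are left empty, so the same stacks can be used again.
  runs : ∀ a, prog.Runs (ports X (ea a) fun _ => []) (time.eval (len (ea a)))
    (ports X (fun _ => []) (eb (f a)))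
  -- Needed so that a second machine that is run on this output still takes polynomial time in the
  -- original input.
  len_le : ∀ a, len (eb (f a)) ≤ time.eval (len (ea a))

attribute [instance] Machine.finW Machine.decW

/-- The function `f` between types of objects that are coded as tuples of strings is computable in
polynomial time. -/
def PolyTime (ea : α → ι → List Symb) (eb : β → κ → List Symb) (f : α → β) : Prop :=
  Nonempty (Machine X ea eb f)

/-- The program of a machine, placed among other stacks of the same kind. -/
def Machine.place {X : Type} {ea : α → ι → List Symb} {eb : β → κ → List Symb} {f : α → β}
    (M : Machine X ea eb f) {K : Type} [DecidableEq K] (e : M.W ⊕ (ι ⊕ κ) → K)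
    (he : Function.Injective e) : Prog fun _ : K => Symb ⊕ X :=
  M.prog.embed (.ofInj _ e he)

theorem Machine.runs_place {X : Type} {ea : α → ι → List Symb} {eb : β → κ → List Symb} {f : α → β}
    (M : Machine X ea eb f) {K : Type} [DecidableEq K] {e : M.W ⊕ (ι ⊕ κ) → K}
    {he : Function.Injective e} {S S' : K → List (Symb ⊕ X)} (a : α)
    (hS : ∀ k, S (e k) = ports X (ea a) (fun _ => []) k)
    (hS' : ∀ k, S' (e k) = ports X (fun _ => []) (eb (f a)) k)
    (hSS' : ∀ j, S' j = S j ∨ ∃ k, e k = j) {n : ℕ} (hn : len (ea a) ≤ n) :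
    (M.place e he).Runs S (M.time.eval n) S' := by
  refine ((M.runs a).embed (E := .ofInj _ e he) (fun k => ?_) (fun k => ?_) hSS').mono
    (eval_mono _ hn)
  · exact (hS k).trans (List.map_id _).symm
  · exact (hS' k).trans (List.map_id _).symm

variable {X}

theorem PolyTime.congr {ea : α → ι → List Symb} {eb : β → κ → List Symb} {eb' : γ → κ → List Symb}
    {f : α → β} {f' : α → γ} (h : PolyTime X ea eb f) (hf : ∀ a, eb (f a) = eb' (f' a)) :
    PolyTime X ea eb' f' := by
  obtain ⟨M⟩ := h
  exact ⟨⟨M.W, M.prog, M.time, fun a => by rw [← hf]; exact M.runs a,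
    fun a => by rw [← hf]; exact M.len_le a⟩⟩

theorem PolyTime.precomp {ea : α → ι → List Symb} {eb : β → κ → List Symb}
    {f : α → β} (h : PolyTime X ea eb f) (g : γ → α) :
    PolyTime X (fun c => ea (g c)) eb (fun c => f (g c)) := by
  obtain ⟨M⟩ := h
  exact ⟨⟨M.W, M.prog, M.time, fun a => M.runs (g a), fun a => M.len_le (g a)⟩⟩

/-- The intermediate strings lie on the stacks `κ`, which become work stacks of the composite. Their
length is bounded by `M.time`, whence the bound `N.time.comp M.time` for the second run. -/
theorem PolyTime.comp {ea : α → ι → List Symb} {eb : β → κ → List Symb} {ec : γ → μ → List Symb}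
    {g : β → γ} {f : α → β} (hg : PolyTime X eb ec g) (hf : PolyTime X ea eb f) :
    PolyTime X ea ec (fun a => g (f a)) := by
  obtain ⟨M⟩ := hf
  obtain ⟨N⟩ := hg
  let e₁ : M.W ⊕ (ι ⊕ κ) → (M.W ⊕ (N.W ⊕ κ)) ⊕ (ι ⊕ μ) :=
    Sum.elim (fun w => .inl (.inl w)) (Sum.elim (fun i => .inr (.inl i))
      fun j => .inl (.inr (.inr j)))
  let e₂ : N.W ⊕ (κ ⊕ μ) → (M.W ⊕ (N.W ⊕ κ)) ⊕ (ι ⊕ μ) :=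
    Sum.elim (fun w => .inl (.inr (.inl w))) (Sum.elim (fun j => .inl (.inr (.inr j)))
      fun i => .inr (.inr i))
  have he₁ : Function.Injective e₁ := by rintro (a | a | a) (b | b | b) h <;> simp_all [e₁]
  have he₂ : Function.Injective e₂ := by rintro (a | a | a) (b | b | b) h <;> simp_all [e₂]
  refine ⟨⟨M.W ⊕ (N.W ⊕ κ), (M.place e₁ he₁).seq (N.place e₂ he₂),
    M.time + N.time.comp M.time, fun a => ?_, fun a => ?_⟩⟩
  · rw [Polynomial.eval_add, Polynomial.eval_comp]
    let U : (M.W ⊕ (N.W ⊕ κ)) ⊕ (ι ⊕ μ) → List (Symb ⊕ X) :=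
      Sum.elim (Sum.elim (fun _ => []) (Sum.elim (fun _ => []) fun j => (eb (f a) j).map .inl))
        fun _ => []
    refine (M.runs_place (S' := U) a ?_ ?_ ?_ le_rfl).seq
      (N.runs_place (f a) ?_ ?_ ?_ (M.len_le a))
    · rintro (a | a | a) <;> rfl
    · rintro (a | a | a) <;> rfl
    · rintro ((w | w | j) | (i | i))
      · exact .inl rfl
      · exact .inl rfl
      · exact .inr ⟨.inr (.inr j), rfl⟩
      · exact .inr ⟨.inr (.inl i), rfl⟩
      · exact .inl rfl
    · rintro (a | a | a) <;> rfl
    · rintro (a | a | a) <;> rfl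
    · rintro ((w | w | j) | (i | i))
      · exact .inl rfl
      · exact .inl rfl
      · exact .inr ⟨.inr (.inl j), rfl⟩
      · exact .inl rfl
      · exact .inr ⟨.inr (.inr i), rfl⟩
  · rw [Polynomial.eval_add, Polynomial.eval_comp]
    exact ((N.len_le _).trans (eval_mono _ (M.len_le a))).trans (Nat.le_add_left _ _)

/-- Two functions computed side by side. -/
theorem PolyTime.prodMap {ea : α → ι → List Symb} {eb : β → κ → List Symb} {ec : γ → μ → List Symb}
    {ed : δ → ν → List Symb} {f : α → γ} {g : β → δ} (hf : PolyTime X ea ec f)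
    (hg : PolyTime X eb ed g) :
    PolyTime X (fun p : α × β => Sum.elim (ea p.1) (eb p.2))
      (fun p : γ × δ => Sum.elim (ec p.1) (ed p.2)) (Prod.map f g) := by
  obtain ⟨M⟩ := hf
  obtain ⟨N⟩ := hg
  let e₁ : M.W ⊕ (ι ⊕ μ) → (M.W ⊕ N.W) ⊕ ((ι ⊕ κ) ⊕ (μ ⊕ ν)) :=
    Sum.elim (fun w => .inl (.inl w)) (Sum.elim (fun i => .inr (.inl (.inl i)))
      fun j => .inr (.inr (.inl j)))
  let e₂ : N.W ⊕ (κ ⊕ ν) → (M.W ⊕ N.W) ⊕ ((ι ⊕ κ) ⊕ (μ ⊕ ν)) :=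
    Sum.elim (fun w => .inl (.inr w)) (Sum.elim (fun i => .inr (.inl (.inr i)))
      fun j => .inr (.inr (.inr j)))
  have he₁ : Function.Injective e₁ := by rintro (a | a | a) (b | b | b) h <;> simp_all [e₁]
  have he₂ : Function.Injective e₂ := by rintro (a | a | a) (b | b | b) h <;> simp_all [e₂]
  have hlen : ∀ {ι κ : Type} [Fintype ι] [Fintype κ] (x : ι → List Symb) (y : κ → List Symb),
      len (Sum.elim x y) = len x + len y := fun x y => by simp [len]
  refine ⟨⟨M.W ⊕ N.W, (M.place e₁ he₁).seq (N.place e₂ he₂),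
    M.time + N.time, fun ⟨a, b⟩ => ?_, fun ⟨a, b⟩ => ?_⟩⟩
  · rw [Polynomial.eval_add]
    let U : (M.W ⊕ N.W) ⊕ ((ι ⊕ κ) ⊕ (μ ⊕ ν)) → List (Symb ⊕ X) :=
      Sum.elim (fun _ => []) (Sum.elim (Sum.elim (fun _ => []) fun i => (eb b i).map .inl)
        (Sum.elim (fun i => (ec (f a) i).map .inl) fun _ => []))
    refine (M.runs_place (S' := U) a ?_ ?_ ?_ ?_).seq
      (N.runs_place b ?_ ?_ ?_ ?_)
    · rintro (a | a | a) <;> rfl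
    · rintro (a | a | a) <;> rfl
    · rintro ((w | w) | (i | i) | (i | i))
      · exact .inl rfl
      · exact .inl rfl
      · exact .inr ⟨.inr (.inl i), rfl⟩
      · exact .inl rfl
      · exact .inr ⟨.inr (.inr i), rfl⟩
      · exact .inl rfl
    · exact (Nat.le_add_right _ _).trans (hlen _ _).ge
    · rintro (a | a | a) <;> rfl
    · rintro (a | a | a) <;> rfl
    · rintro ((w | w) | (i | i) | (i | i))
      · exact .inl rfl
      · exact .inl rfl
      · exact .inl rfl
      · exact .inr ⟨.inr (.inl i), rfl⟩
      · exact .inl rfl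
      · exact .inr ⟨.inr (.inr i), rfl⟩
    · exact (Nat.le_add_left _ _).trans (hlen _ _).ge
  · rw [Polynomial.eval_add]
    refine (hlen _ _).le.trans (add_le_add ((M.len_le _).trans (eval_mono _ ?_))
      ((N.len_le _).trans (eval_mono _ ?_)))
    · exact (Nat.le_add_right _ _).trans (hlen _ _).ge
    · exact (Nat.le_add_left _ _).trans (hlen _ _).ge

theorem getLeft?_inl {X : Type} (x : Symb) : Sum.getLeft? (Sum.inl x : Symb ⊕ X) = some x := rfl

/-- Each output string is empty or a copy of an input string. -/
theorem PolyTime.wire {ea : α → ι → List Symb} {eb : β → κ → List Symb} {f : α → β}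
    (e : κ → Option ι) (hf : ∀ a j, eb (f a) j = (e j).elim [] (ea a)) : PolyTime X ea eb f := by
  let out (i : ι) : List (Unit ⊕ (ι ⊕ κ)) :=
    (Finset.univ.filter fun j => e j = some i).toList.map fun j => .inr (.inr j)
  -- A transfer reverses a string, so each input passes through one auxiliary stack and then goes to
  -- all its destinations at once.
  let move (i : ι) : Prog fun _ : Unit ⊕ (ι ⊕ κ) => Symb ⊕ X :=
    (Prog.transfer (.inr (.inl i)) Sum.getLeft? [(.inl ())] fun x _ => .inl x).seq
      (Prog.transfer (.inl ()) Sum.getLeft? (out i) fun x _ => .inl x)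
  let P (l : List ι) : Prog fun _ : Unit ⊕ (ι ⊕ κ) => Symb ⊕ X := l.foldr (fun i Q => (move i).seq Q) (.skip _)
  have hnd : ∀ i, (out i).Nodup := fun i =>
    (Finset.nodup_toList _).map fun a b h => Sum.inr_injective (Sum.inr_injective h)
  have hout : ∀ i j, (.inr (.inr j) : Unit ⊕ (ι ⊕ κ)) ∈ out i ↔ e j = some i := by simp [out]
  have hin : ∀ i i', (.inr (.inl i') : Unit ⊕ (ι ⊕ κ)) ∉ out i := by simp [out]
  have hinl : ∀ i, (.inl () : Unit ⊕ (ι ⊕ κ)) ∉ out i := by simp [out]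
  -- The inputs in `l` are still in place, the others have been delivered.
  have key : ∀ (x : ι → List Symb) (l : List ι), l.Nodup →
      (P l).Runs (ports X (fun i => if i ∈ l then x i else [])
          (fun j => (e j).elim [] fun i => if i ∈ l then [] else x i))
        ((l.map fun i => 4 * (x i).length + 4).sum + 1)
        (ports X (fun _ => []) fun j => (e j).elim [] x) := by
    intro x l hl
    induction l with
    | nil => exact Prog.runs_skip _
    | cons i l ih =>
      have hi : i ∉ l := (List.nodup_cons.1 hl).1
      let S : Unit ⊕ (ι ⊕ κ) → List (Symb ⊕ X) := ports X (fun i' => if i' ∈ i :: l then x i' else [])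
          (fun j => (e j).elim [] fun i' => if i' ∈ i :: l then [] else x i')
      let U : Unit ⊕ (ι ⊕ κ) → List (Symb ⊕ X) := Sum.elim (fun _ => ((x i).map .inl).reverse)
        (Sum.elim (fun i' => (if i' ∈ l then x i' else []).map .inl)
          fun j => ((e j).elim [] fun i' => if i' ∈ i :: l then [] else x i').map .inl)
      have h₁ := Prog.runs_transfer (k := .inr (.inl i)) (T := Symb) (dec := Sum.getLeft?)
        (ts := [(.inl ())]) (w := fun x _ => .inl x) (S := S) (S' := U) (enc := .inl) (l := x i)
        getLeft?_inl (by simp) (by simp) (by simp [S, ports]) (by simp [U, hi])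
        (by simp [U, S, ports]) (by
          rintro (j | j | j) hj hj'
          · exact absurd (List.mem_singleton.2 rfl) hj
          · have hji : j ≠ i := fun h => hj' (by rw [h])
            simp [U, S, ports, hji]
          · rfl)
      have h₂ := Prog.runs_transfer (k := (.inl ())) (T := Symb) (dec := Sum.getLeft?)
        (ts := out i) (w := fun x _ => .inl x) (S := U) (S' := ports X (fun i => if i ∈ l then x i else [])
          (fun j => (e j).elim [] fun i => if i ∈ l then [] else x i)) (enc := .inl) (l := (x i).reverse)
        getLeft?_inl (hnd i) (hinl i) (by simp [U]) (by simp [ports]) (by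
          rintro (j | j | j) hj
          · exact absurd hj (hinl i)
          · exact absurd hj (hin i j)
          · rw [hout] at hj
            simp [U, ports, hj, hi]) (by
          rintro (j | j | j) hj hj'
          · exact absurd rfl hj'
          · rfl
          · rw [hout] at hj
            cases hej : e j with
            | none => simp [U, ports, hej]
            | some i' =>
              have : i' ≠ i := fun h => hj (by rw [hej, h])
              simp [U, ports, hej, this])
      refine ((h₁.seq h₂).seq (ih hl.of_cons)).mono ?_
      simp only [List.length_reverse, List.map_cons, List.sum_cons]
      omega
  refine ⟨⟨Unit, P Finset.univ.toList,
    -- Two transfers cost four steps per letter and four per input string, and `skip` costs one; the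
    -- summand with `Fintype.card κ` covers the length of the output.
    ((Fintype.card κ + 4 : ℕ) : Polynomial ℕ) * Polynomial.X +
      ((4 * Fintype.card ι + 1 : ℕ) : Polynomial ℕ),
    fun a => ?_, fun a => ?_⟩⟩
  · convert (key (ea a) Finset.univ.toList (Finset.nodup_toList _)).mono ?_ using 1
    · congr 1 <;> funext j
      · simp
      · cases e j <;> simp
    · congr 1
      funext j
      exact hf a j
    · rw [Finset.sum_map_toList]
      simp only [Finset.sum_add_distrib, ← Finset.mul_sum, Polynomial.eval_add,
        Polynomial.eval_mul, Polynomial.eval_natCast, Polynomial.eval_X, len, Finset.sum_const,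
        Finset.card_univ, smul_eq_mul, Nat.cast_id]
      nlinarith [Nat.zero_le (Fintype.card κ * ∑ i, (ea a i).length)]
  · have : len (eb (f a)) ≤ Fintype.card κ * len (ea a) := by
      rw [← Finset.card_univ, ← smul_eq_mul]
      refine Finset.sum_le_card_nsmul _ _ _ fun j _ => ?_
      rw [hf]
      cases e j with
      | none => exact Nat.zero_le _
      | some i =>
        exact Finset.single_le_sum (f := fun i => (ea a i).length)
          (fun _ _ => Nat.zero_le _) (Finset.mem_univ i)
    simp only [Polynomial.eval_add, Polynomial.eval_mul, Polynomial.eval_natCast, Polynomial.eval_X,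
      Nat.cast_id]
    nlinarith

/-- Push some letters onto the output stacks. -/
theorem PolyTime.pushes {ea : α → ι → List Symb} {eb : β → κ → List Symb}
    {eb' : γ → κ → List Symb} {f : α → β} {f' : α → γ} (h : PolyTime X ea eb f)
    (l : κ → List Symb) (hf : ∀ a j, eb' (f' a) j = l j ++ eb (f a) j) :
    PolyTime X ea eb' f' := by
  obtain ⟨M⟩ := h
  have hone : ∀ (k : M.W ⊕ (ι ⊕ κ)) (w : List (Symb ⊕ X)),
      ∃ L : List (Σ _ : M.W ⊕ (ι ⊕ κ), Symb ⊕ X), ∀ S,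
        Prog.pushAll L S = Function.update S k (w ++ S k) := by
    intro k w
    induction w with
    | nil => exact ⟨[], fun S => by simp [Prog.pushAll]⟩
    | cons x w ih =>
      obtain ⟨L, hL⟩ := ih
      refine ⟨L ++ [⟨k, x⟩], fun S => ?_⟩
      have : Prog.pushAll (L ++ [⟨k, x⟩]) S = Prog.pushAll [⟨k, x⟩] (Prog.pushAll L S) :=
        List.foldl_append
      rw [this, hL]
      simp [Prog.pushAll]
  have hall : ∀ s : Finset κ, ∃ L : List (Σ _ : M.W ⊕ (ι ⊕ κ), Symb ⊕ X),
      ∀ x, Prog.pushAll L (ports X (fun _ => []) x) =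
        ports X (fun _ => []) (fun j => if j ∈ s then l j ++ x j else x j) := by
    intro s
    induction s using Finset.induction_on with
    | empty => exact ⟨[], fun x => by simp [Prog.pushAll]⟩
    | insert j s hj ih =>
      obtain ⟨L, hL⟩ := ih
      obtain ⟨L', hL'⟩ := hone (.inr (.inr j)) ((l j).map .inl)
      refine ⟨L ++ L', fun x => ?_⟩
      have : ∀ S, Prog.pushAll (L ++ L') S = Prog.pushAll L' (Prog.pushAll L S) :=
        fun S => List.foldl_append
      rw [this, hL, hL']
      funext k
      by_cases hk : k = .inr (.inr j)
      · subst hk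
        simp [ports, hj]
      · rw [Function.update_of_ne hk]
        rcases k with k | k | k
        · rfl
        · rfl
        · have : k ≠ j := fun h => hk (by rw [h])
          simp [ports, this]
  obtain ⟨L, hL⟩ := hall Finset.univ
  refine ⟨⟨M.W, M.prog.seq (.pushes L), M.time + 1 + (len l : ℕ), fun a => ?_, fun a => ?_⟩⟩
  · convert ((M.runs a).seq (Prog.runs_pushes L _)).mono ?_ using 1
    · rw [hL]
      congr 1
      funext j
      simp [hf]
    · simp
  · have := M.len_le a
    have h₂ : len (eb' (f' a)) = len l + len (eb (f a)) := by
      simp [len, hf, Finset.sum_add_distrib]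
    rw [h₂]
    simp
    omega

end

end StackMachine

end

/-! ### Case distinction and iteration on strings -/

noncomputable section

namespace StackMachine

open BoolFormula

/-- A finite alphabet whose letters are represented by symbols. -/
class Letter (T : Type) extends Fintype T where
  toSymb : T → Symb
  ofSymb : Symb → Option T
  of_to : ∀ x, ofSymb (toSymb x) = some x

instance : Letter Symb where
  toSymb := id
  ofSymb := some
  of_to _ := rfl

instance : Letter Bool where
  toSymb := .bit
  ofSymb
    | .bit b => some b
    | _ => none
  of_to _ := rfl

instance : Letter (Bool ⊕ Bool) where
  toSymb := Sum.elim .const .bit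
  ofSymb
    | .const b => some (.inl b)
    | .bit b => some (.inr b)
    | _ => none
  of_to x := by cases x <;> rfl

section

variable {X : Type} {ι κ : Type} [Fintype ι] [Fintype κ] [DecidableEq ι] [DecidableEq κ]
  {α β : Type} {T : Type} [Letter T]

theorem len_elim {ι κ : Type} [Fintype ι] [Fintype κ] (x : ι → List Symb) (y : κ → List Symb) :
    len (Sum.elim x y) = len x + len y := by simp [len]

theorem len_unit (x : Unit → List Symb) : len x = (x ()).length := by simp [len]

/-- Read a letter of the alphabet `T` from a stack of a machine. -/
def readLetter (X T : Type) [Letter T] (x : Symb ⊕ X) : Option T :=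
  x.getLeft?.bind Letter.ofSymb

theorem readLetter_inl (x : T) : readLetter X T (.inl (Letter.toSymb x)) = some x :=
  Letter.of_to x

/-- Definition by cases according to the first letter of a string. -/
theorem PolyTime.popCases {ea : α → ι → List Symb} {eb : β → κ → List Symb} {l : α → List T}
    {h : Option T → α → β}
    (hh : ∀ o, PolyTime X (fun a => Sum.elim (ea a) fun _ : Unit => (l a).tail.map Letter.toSymb)
      eb (h o)) :
    PolyTime X (fun a => Sum.elim (ea a) fun _ : Unit => (l a).map Letter.toSymb)
      eb (fun a => h (l a).head? a) := by
  classical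
  have M := fun o => Classical.choice (hh o)
  let e (o : Option T) : (M o).W ⊕ ((ι ⊕ Unit) ⊕ κ) → (Σ o, (M o).W) ⊕ ((ι ⊕ Unit) ⊕ κ) :=
    Sum.elim (fun w => .inl ⟨o, w⟩) .inr
  have he : ∀ o, Function.Injective (e o) := by
    rintro o (a | a) (b | b) h <;> simp_all [e]
  refine ⟨⟨Σ o, (M o).W, .dispatch (.inr (.inl (.inr ()))) (readLetter X T)
    (fun o => (M o).place (e o) (he o)) fun _ => false, ∑ o, (M o).time + 1,
    fun a => ?_, fun a => ?_⟩⟩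
  · have hlen : len (Sum.elim (ea a) fun _ : Unit => (l a).tail.map Letter.toSymb) ≤
        len (Sum.elim (ea a) fun _ : Unit => (l a).map Letter.toSymb) := by
      simp [len_elim, len_unit]
    refine (Prog.runs_dispatch (o := (l a).head?) ?_
      ((M (l a).head?).runs_place a ?_ ?_ ?_ hlen) rfl).mono ?_
    · cases hl : l a with
      | nil => simp [ports]
      | cons x t => simp [ports, readLetter_inl]
    · rintro (k | (k | k) | k)
      · rfl
      · rfl
      · simp [e, ports]
      · rfl
    · rintro (k | k) <;> rfl
    · rintro (k | k | k)
      · exact .inl rfl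
      · exact .inr ⟨.inr (.inl k), rfl⟩
      · exact .inr ⟨.inr (.inr k), rfl⟩
    · rw [Polynomial.eval_add, Polynomial.eval_finsetSum, Polynomial.eval_one]
      exact Nat.add_le_add_right (Finset.single_le_sum (f := fun o => (M o).time.eval _)
        (fun _ _ => Nat.zero_le _) (Finset.mem_univ _)) 1
  · have hlen : len (Sum.elim (ea a) fun _ : Unit => (l a).tail.map Letter.toSymb) ≤
        len (Sum.elim (ea a) fun _ : Unit => (l a).map Letter.toSymb) := by
      simp [len_elim, len_unit]
    rw [Polynomial.eval_add, Polynomial.eval_finsetSum, Polynomial.eval_one]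
    refine (((M (l a).head?).len_le a).trans (eval_mono _ hlen)).trans (Nat.le_succ_of_le ?_)
    exact Finset.single_le_sum (f := fun o => (M o).time.eval _)
      (fun _ _ => Nat.zero_le _) (Finset.mem_univ _)

/-- Iteration along a string, when the intermediate results have polynomial length. -/
theorem PolyTime.foldl {eb : β → ι → List Symb} {s : T → β → β}
    (hs : ∀ x, PolyTime X eb eb (s x)) {g : α → β} {k : α → List T} (q : Polynomial ℕ)
    (hq : ∀ a l, l <+: k a →
      len (eb (l.foldl (fun b x => s x b) (g a))) ≤ q.eval (len (eb (g a)) + (k a).length)) :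
    PolyTime X (fun a => Sum.elim (eb (g a)) fun _ : Unit => (k a).map Letter.toSymb) eb
      (fun a => (k a).foldl (fun b x => s x b) (g a)) := by
  classical
  have M := fun x => Classical.choice (hs x)
  obtain ⟨N⟩ : PolyTime X eb eb id := PolyTime.wire some fun _ _ => rfl
  let e₁ (x : T) : (M x).W ⊕ (ι ⊕ ι) → (((Σ x, (M x).W) ⊕ N.W) ⊕ ι) ⊕ ((ι ⊕ Unit) ⊕ ι) :=
    Sum.elim (fun w => .inl (.inl (.inl ⟨x, w⟩))) (Sum.elim (fun i => .inr (.inl (.inl i)))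
      fun i => .inl (.inr i))
  let e₂ : N.W ⊕ (ι ⊕ ι) → (((Σ x, (M x).W) ⊕ N.W) ⊕ ι) ⊕ ((ι ⊕ Unit) ⊕ ι) :=
    Sum.elim (fun w => .inl (.inl (.inr w))) (Sum.elim (fun i => .inl (.inr i))
      fun i => .inr (.inl (.inl i)))
  let e₃ : N.W ⊕ (ι ⊕ ι) → (((Σ x, (M x).W) ⊕ N.W) ⊕ ι) ⊕ ((ι ⊕ Unit) ⊕ ι) :=
    Sum.elim (fun w => .inl (.inl (.inr w))) (Sum.elim (fun i => .inr (.inl (.inl i)))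
      fun i => .inr (.inr i))
  have he₁ : ∀ x, Function.Injective (e₁ x) := by
    rintro x (a | a | a) (b | b | b) h <;> simp_all [e₁]
  have he₂ : Function.Injective e₂ := by
    rintro (a | a | a) (b | b | b) h <;> simp_all [e₂]
  have he₃ : Function.Injective e₃ := by
    rintro (a | a | a) (b | b | b) h <;> simp_all [e₃]
  let store (b b' c : ι → List Symb) (l : List T) :
      (((Σ x, (M x).W) ⊕ N.W) ⊕ ι) ⊕ ((ι ⊕ Unit) ⊕ ι) → List (Symb ⊕ X) :=
    Sum.elim (Sum.elim (fun _ => []) fun i => (b' i).map .inl)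
      (Sum.elim (Sum.elim (fun i => (b i).map .inl) fun _ => l.map fun x => .inl (Letter.toSymb x))
        fun i => (c i).map .inl)
  let emp : ι → List Symb := fun _ => []
  -- A round writes its result on auxiliary stacks; the identity machine `N` carries it back to
  -- where the next round reads.
  let body (x : T) := ((M x).place (e₁ x) (he₁ x)).seq (N.place e₂ he₂)
  let p : Polynomial ℕ := (∑ x, (M x).time).comp q + N.time.comp q
  refine ⟨⟨_, (Prog.forEach (.inr (.inl (.inr ()))) (readLetter X T) body).seq (N.place e₃ he₃),
    Polynomial.X * (p + 1) + 2 + N.time.comp q + q, fun a => ?_, fun a => ?_⟩⟩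
  · set n := len (eb (g a)) + (k a).length with hn
    have hn' : len (Sum.elim (eb (g a)) fun _ : Unit => (k a).map Letter.toSymb) = n := by
      simp [len_elim, len_unit, hn]
    rw [hn']
    -- The intermediate result when the letters `l` are left.
    let val (l : List T) : β := ((k a).take ((k a).length - l.length)).foldl (fun b x => s x b) (g a)
    have hval : ∀ l, len (eb (val l)) ≤ q.eval n := fun l => hq a _ (List.take_prefix _ _)
    have key := Prog.runs_forEach (k := .inr (.inl (.inr ()))) (dec := readLetter X T) (P := body)
      (enc := fun x => .inl (Letter.toSymb x)) readLetter_inl (k a)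
      (fun l => store (eb (val l)) emp emp l) (fun l => rfl) (p.eval n) (fun x l hl => by
        have hv : val l = s x (val (x :: l)) := by
          obtain ⟨l₀, hl₀⟩ := hl
          have h₁ : l₀.length + (l.length + 1) - l.length = l₀.length + 1 := by omega
          have h₂ : l₀.length + (l.length + 1) - (l.length + 1) = l₀.length := by omega
          simp [val, ← hl₀, h₁, List.take_append, List.take_of_length_le]
        have hupd : Function.update (store (eb (val (x :: l))) emp emp (x :: l))
            (.inr (.inl (.inr ()))) (l.map fun x => .inl (Letter.toSymb x)) =
            store (eb (val (x :: l))) emp emp l := by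
          funext j
          rcases j with ((j | j) | j) | ((j | j) | j) <;> rfl
        rw [hupd]
        refine (((M x).runs_place (val (x :: l)) (S' := store emp (eb (val l)) emp l)
          ?_ ?_ ?_ (hval _)).seq (N.runs_place (val l) ?_ ?_ ?_ (hval _))).mono ?_
        · rintro (j | j | j) <;> rfl
        · rw [hv]
          rintro (j | j | j) <;> rfl
        · rintro (((j | j) | j) | ((j | j) | j))
          · exact .inl rfl
          · exact .inl rfl
          · exact .inr ⟨.inr (.inr j), rfl⟩
          · exact .inr ⟨.inr (.inl j), rfl⟩
          · exact .inl rfl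
          · exact .inl rfl
        · rintro (j | j | j) <;> rfl
        · rintro (j | j | j) <;> rfl
        · rintro (((j | j) | j) | ((j | j) | j))
          · exact .inl rfl
          · exact .inl rfl
          · exact .inr ⟨.inr (.inl j), rfl⟩
          · exact .inr ⟨.inr (.inr j), rfl⟩
          · exact .inl rfl
          · exact .inl rfl
        · simp only [p, Polynomial.eval_add, Polynomial.eval_comp, Polynomial.eval_finsetSum]
          exact Nat.add_le_add_right (Finset.single_le_sum
            (f := fun x => (M x).time.eval (q.eval n)) (fun _ _ => Nat.zero_le _)
            (Finset.mem_univ x)) _)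
    have h₀ : store (eb (val (k a))) emp emp (k a) =
        ports X (Sum.elim (eb (g a)) fun _ : Unit => (k a).map Letter.toSymb) fun _ => [] := by
      have : val (k a) = g a := by simp [val]
      rw [this]
      funext j
      rcases j with ((j | j) | j) | ((j | j) | j)
      · rfl
      · rfl
      · rfl
      · rfl
      · simp [store, ports]
      · rfl
    rw [h₀] at key
    have hval₀ : val [] = (k a).foldl (fun b x => s x b) (g a) := by simp [val]
    refine (key.seq (N.runs_place (val []) ?_ ?_ ?_ (hval []))).mono ?_
    · rintro (j | j | j) <;> rfl
    · rw [← hval₀]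
      rintro (j | j | j) <;> rfl
    · rintro (((j | j) | j) | ((j | j) | j))
      · exact .inl rfl
      · exact .inl rfl
      · exact .inl rfl
      · exact .inr ⟨.inr (.inl j), rfl⟩
      · exact .inl rfl
      · exact .inr ⟨.inr (.inr j), rfl⟩
    · have := Nat.mul_le_mul_right (p.eval n + 1) (Nat.le_add_left (k a).length (len (eb (g a))))
      rw [← hn] at this
      simp only [Polynomial.eval_add, Polynomial.eval_mul, Polynomial.eval_X,
        Polynomial.eval_one, Polynomial.eval_comp, Polynomial.eval_ofNat]
      omega
  · refine (hq a (k a) (List.prefix_refl _)).trans ?_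
    rw [len_elim, len_unit, List.length_map, Polynomial.eval_add (q := q)]
    exact Nat.le_add_left _ _

end

end StackMachine

end

noncomputable section

namespace StackMachine

open BoolFormula

/-! ### Polynomial-time functions between data types -/

/-- A type whose elements are represented by tuples of strings. -/
class Data (α : Type) where
  ι : Type
  [fin : Fintype ι]
  [dec : DecidableEq ι]
  enc : α → ι → List Symb

attribute [reducible, instance] Data.fin Data.dec

instance {α β : Type} [Data α] [Data β] : Data (α × β) where
  ι := Data.ι α ⊕ Data.ι β
  enc p := Sum.elim (Data.enc p.1) (Data.enc p.2)

instance {T : Type} [Letter T] : Data (List T) where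
  ι := Unit
  enc l _ := l.map Letter.toSymb

instance : Data Bool where
  ι := Unit
  enc b _ := [.bit b]

instance : Data BoolFormula where
  ι := Unit
  enc F _ := F.encode

instance : Data ℕ where
  ι := Unit
  enc n _ := (Computability.encodeNat n).map .bit

/-- The total length of the strings that represent an object. -/
def size {α : Type} [Data α] (a : α) : ℕ := len (Data.enc a)

/-- The function `f` is computable in polynomial time. -/
@[fun_prop]
def PT (X : Type) {α β : Type} [Data α] [Data β] (f : α → β) : Prop :=
  PolyTime X Data.enc Data.enc f

section

variable {X α β γ δ T : Type} [Data α] [Data β] [Data γ] [Data δ] [Letter T]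

@[simp] theorem size_prod (p : α × β) : size p = size p.1 + size p.2 := len_elim _ _

@[simp] theorem size_list (l : List T) : size l = l.length :=
  (len_unit _).trans (List.length_map _)

@[simp] theorem size_bool (b : Bool) : size b = 1 := len_unit _

@[simp] theorem size_formula (F : BoolFormula) : size F = F.encode.length := len_unit _

@[simp] theorem size_nat (n : ℕ) : size n = (Computability.encodeNat n).length :=
  (len_unit _).trans (List.length_map _)

namespace PT

@[fun_prop]
theorem id : PT X (fun a : α => a) := PolyTime.wire some fun _ _ => rfl

@[fun_prop]
theorem const (b : β) : PT X (fun _ : α => b) :=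
  PolyTime.pushes (f := fun _ => ()) (eb := fun _ _ => []) (PolyTime.wire (fun _ => none)
    fun _ _ => rfl) (Data.enc b) fun _ _ => (List.append_nil _).symm

@[fun_prop]
theorem comp {g : β → γ} {f : α → β} (hg : PT X g) (hf : PT X f) : PT X (fun a => g (f a)) :=
  PolyTime.comp hg hf

theorem of_eq {f g : α → β} (hf : PT X f) (h : ∀ a, f a = g a) : PT X g := by
  rwa [← funext h]

@[fun_prop]
theorem fst {f : α → β × γ} (hf : PT X f) : PT X (fun a => (f a).1) :=
  (PolyTime.wire (ea := Data.enc (α := β × γ)) (f := Prod.fst) (fun j => some (.inl j))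
    fun _ _ => rfl).comp hf

@[fun_prop]
theorem snd {f : α → β × γ} (hf : PT X f) : PT X (fun a => (f a).2) :=
  (PolyTime.wire (ea := Data.enc (α := β × γ)) (f := Prod.snd) (fun j => some (.inr j))
    fun _ _ => rfl).comp hf

@[fun_prop]
theorem pair {f : α → β} {g : α → γ} (hf : PT X f) (hg : PT X g) : PT X (fun a => (f a, g a)) := by
  have hdup : PT X (fun a : α => (a, a)) :=
    PolyTime.wire (fun j => some (j.elim _root_.id _root_.id)) fun a j => by cases j <;> rfl
  exact (PolyTime.prodMap hf hg).comp hdup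

@[fun_prop]
theorem cons (x : T) {f : α → List T} (hf : PT X f) : PT X (fun a => x :: f a) :=
  PolyTime.pushes hf (fun _ => [Letter.toSymb x]) fun _ _ => rfl

end PT

/-- Definition by cases for lists. -/
def listCase (l : List T) (b : β) (h : T → List T → β) : β :=
  match l with
  | [] => b
  | x :: t => h x t

namespace PT

@[fun_prop]
-- The popped list is a separate copy in the pair `(a, l a)`, so every branch still has `a` at its
-- disposal.
theorem listCase {l : α → List T} {b : α → β} {h : α → T → List T → β} (hl : PT X l)
    (hb : PT X b) (hh : ∀ x, PT X (fun p : α × List T => h p.1 x p.2)) :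
    PT X (fun a => listCase (l a) (b a) (h a)) := by
  have h₁ := PolyTime.popCases (X := X) (ea := Data.enc (α := α)) (l := l)
    (eb := Data.enc (α := β)) (h := fun o a => o.elim (b a) fun x => h a x (l a).tail) (fun o => by
      cases o with
      | none => exact PolyTime.precomp (PT.comp hb (PT.fst PT.id)) fun a => (a, (l a).tail)
      | some x => exact PolyTime.precomp (hh x) fun a => (a, (l a).tail))
  have h₂ : PolyTime X Data.enc (fun a => Sum.elim (Data.enc a) fun _ : Unit =>
      (l a).map Letter.toSymb) (fun a : α => a) :=
    PolyTime.congr (PT.pair PT.id hl) fun a => rfl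
  refine of_eq (h₁.comp h₂) fun a => ?_
  cases h : l a <;> rfl

@[fun_prop]
-- A Boolean is represented like a list with one letter, so this is a case of `listCase`.
theorem cond {c : α → Bool} {f g : α → β} (hc : PT X c) (hf : PT X f) (hg : PT X g) :
    PT X (fun a => bif c a then f a else g a) := by
  have hc' : PT X (fun a => [c a]) := PolyTime.congr hc fun a => rfl
  refine of_eq (listCase (h := fun a x _ => bif x then f a else g a) hc' hg fun x => ?_)
    fun a => rfl
  cases x
  · exact hg.comp (fst id)
  · exact hf.comp (fst id)

@[fun_prop]
theorem and {f g : α → Bool} (hf : PT X f) (hg : PT X g) : PT X (fun a => f a && g a) :=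
  of_eq (cond hf hg (const false)) fun a => by cases f a <;> rfl

@[fun_prop]
theorem or {f g : α → Bool} (hf : PT X f) (hg : PT X g) : PT X (fun a => f a || g a) :=
  of_eq (cond hf (const true) hg) fun a => by cases f a <;> rfl

@[fun_prop]
theorem not {f : α → Bool} (hf : PT X f) : PT X (fun a => !f a) :=
  of_eq (cond hf (const false) (const true)) fun a => by cases f a <;> rfl

@[fun_prop]
theorem xor {f g : α → Bool} (hf : PT X f) (hg : PT X g) : PT X (fun a => f a ^^ g a) :=
  of_eq (cond hf (not hg) hg) fun a => by cases f a <;> cases g a <;> rfl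

@[fun_prop]
theorem beq {f g : α → Bool} (hf : PT X f) (hg : PT X g) : PT X (fun a => f a == g a) :=
  of_eq (not (xor hf hg)) fun a => by cases f a <;> cases g a <;> rfl

@[fun_prop]
theorem tail {f : α → List T} (hf : PT X f) : PT X (fun a => (f a).tail) :=
  of_eq (listCase (h := fun _ _ t => t) hf (const []) fun _ => snd id) fun a => by
    cases f a <;> rfl

@[fun_prop]
theorem headD {f : α → List Bool} (hf : PT X f) (b : Bool) : PT X (fun a => (f a).headD b) :=
  of_eq (listCase (h := fun _ x _ => x) hf (const b) fun x => const x) fun a => by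
    cases f a <;> rfl

@[fun_prop]
theorem consBool {f : α → Bool} {g : α → List Bool} (hf : PT X f) (hg : PT X g) :
    PT X (fun a => f a :: g a) :=
  of_eq (cond hf (cons true hg) (cons false hg)) fun a => by cases f a <;> rfl

theorem foldl {s : T → β → β} (hs : ∀ x, PT X (s x)) {g : α → β} {k : α → List T}
    (hg : PT X g) (hk : PT X k) (q : Polynomial ℕ)
    (hq : ∀ a l, l <+: k a →
      size (l.foldl (fun b x => s x b) (g a)) ≤ q.eval (size (g a) + (k a).length)) :
    PT X (fun a => (k a).foldl (fun b x => s x b) (g a)) :=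
  (PolyTime.foldl hs q hq).comp (f := fun a => a) (PolyTime.congr (pair hg hk) fun _ => rfl)

@[fun_prop]
theorem reverse {f : α → List T} (hf : PT X f) : PT X (fun a => (f a).reverse) := by
  have h : ∀ l m : List T, l.foldl (fun b x => x :: b) m = l.reverse ++ m := by
    intro l
    induction l with
    | nil => intro m; rfl
    | cons x l ih => intro m; simp [ih]
  refine of_eq (foldl (s := List.cons) (fun x => cons x id) (const []) hf Polynomial.X
    fun a l hl => ?_) fun a => (h _ _).trans (List.append_nil _)
  have := hl.length_le
  simpa [h] using this

theorem foldr {s : T → β → β} (hs : ∀ x, PT X (s x)) {g : α → β} {k : α → List T}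
    (hg : PT X g) (hk : PT X k) (q : Polynomial ℕ)
    (hq : ∀ a l, l <:+ k a → size (l.foldr s (g a)) ≤ q.eval (size (g a) + (k a).length)) :
    PT X (fun a => (k a).foldr s (g a)) := by
  refine of_eq (foldl hs hg (reverse hk) q fun a l hl => ?_) fun a => List.foldl_reverse
  rw [List.length_reverse]
  have := hq a l.reverse (by rwa [← List.reverse_prefix, List.reverse_reverse])
  rwa [List.foldr_reverse] at this

/-- Iteration of a step that adds at most a constant to the length. -/
theorem foldr_of_le {s : T → β → β} (hs : ∀ x, PT X (s x)) {g : α → β} {k : α → List T}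
    (hg : PT X g) (hk : PT X k) (c : ℕ) (hc : ∀ x b, size (s x b) ≤ size b + c) :
    PT X (fun a => (k a).foldr s (g a)) := by
  refine foldr hs hg hk (((c + 1 : ℕ) : Polynomial ℕ) * Polynomial.X) fun a l hl => ?_
  have h : ∀ l : List T, size (l.foldr s (g a)) ≤ size (g a) + c * l.length := by
    intro l
    induction l with
    | nil => simp
    | cons x l ih =>
      rw [List.foldr_cons, List.length_cons, Nat.mul_succ]
      have := hc x (l.foldr s (g a))
      omega
  have h₁ := h l
  have h₂ := Nat.mul_le_mul_left c hl.length_le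
  simp only [Polynomial.eval_mul, Polynomial.eval_natCast, Polynomial.eval_X, Nat.cast_id]
  nlinarith [Nat.zero_le (c * size (g a))]

@[fun_prop]
theorem append {f g : α → List T} (hf : PT X f) (hg : PT X g) : PT X (fun a => f a ++ g a) := by
  have h : ∀ l m : List T, l.foldr List.cons m = l ++ m := fun l m => by simp
  exact of_eq (foldr_of_le (fun x => cons x id) hg hf 1 fun x b => by simp) fun a => h _ _

/-! #### Formulas as strings -/

@[fun_prop]
-- A formula is represented by its own string, so passing between the two changes nothing on the
-- stacks. The same holds for numbers and their numerals below.
theorem encode {f : α → BoolFormula} (hf : PT X f) : PT X (fun a => (f a).encode) :=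
  PolyTime.congr hf fun a => by funext; exact (List.map_id _).symm

theorem of_encode {f : α → BoolFormula} (hf : PT X (fun a => (f a).encode)) : PT X f :=
  PolyTime.congr hf fun a => by funext; exact List.map_id _

@[fun_prop]
theorem encodeNat {f : α → ℕ} (hf : PT X f) : PT X (fun a => Computability.encodeNat (f a)) :=
  PolyTime.congr hf fun _ => rfl

theorem of_encodeNat {f : α → ℕ} (hf : PT X (fun a => Computability.encodeNat (f a))) : PT X f :=
  PolyTime.congr hf fun _ => rfl

@[fun_prop]
theorem mapBit {f : α → List Bool} (hf : PT X f) : PT X (fun a => (f a).map Symb.bit) :=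
  PolyTime.congr hf fun a => by funext; exact (List.map_id _).symm

@[fun_prop]
theorem conj {f g : α → BoolFormula} (hf : PT X f) (hg : PT X g) :
    PT X (fun a => (f a).conj (g a)) := by
  apply of_encode
  simp only [BoolFormula.encode]
  fun_prop

@[fun_prop]
theorem disj {f g : α → BoolFormula} (hf : PT X f) (hg : PT X g) :
    PT X (fun a => (f a).disj (g a)) := by
  apply of_encode
  simp only [BoolFormula.encode]
  fun_prop

@[fun_prop]
theorem var {f : α → ℕ} (hf : PT X f) : PT X (fun a => BoolFormula.var (f a)) := by
  apply of_encode
  simp only [BoolFormula.encode, List.cons_append]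
  fun_prop

end PT

end

end StackMachine

end

/-! ### Passing between Turing machines and machines with standard stacks -/

noncomputable section

namespace StackMachine

open BoolFormula

namespace Prog

variable {K : Type} [DecidableEq K] {Γ : K → Type}

/-- Move the letters of the stack `k` to the stack `t`, in reversed order. -/
def move {T : Type} [Fintype T] (k : K) (dec : Γ k → Option T) (t : K) (w : T → Γ t) : Prog Γ :=
  forEach k dec fun x => pushes [⟨t, w x⟩]

/-- In contrast to `transfer`, a letter is specified for the target stack only, which suits stacks
with different alphabets. -/
theorem runs_move {T : Type} [Fintype T] {k : K} {dec : Γ k → Option T} {t : K}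
    {w : T → Γ t} {enc : T → Γ k} (hde : ∀ x, dec (enc x) = some x) (hk : t ≠ k) {l : List T}
    {S S' : ∀ k, List (Γ k)} (hS : S k = l.map enc) (hS' : S' k = [])
    (hT : S' t = (l.map w).reverse ++ S t) (hN : ∀ j, j ≠ t → j ≠ k → S' j = S j) :
    (move k dec t w).Runs S (2 * l.length + 2) S' := by
  let U : List T → ∀ k, List (Γ k) := fun l' => Function.update
    (Function.update S t (((l.take (l.length - l'.length)).map w).reverse ++ S t)) k (l'.map enc)
  have key := runs_forEach (P := fun x => pushes [⟨t, w x⟩]) hde l U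
    (fun l' => by simp [U]) 1 (fun x l' hl' => by
      convert runs_pushes [⟨t, w x⟩] _ using 1
      obtain ⟨l₀, rfl⟩ := hl'
      have h₁ : l₀.length + (l'.length + 1) - l'.length = l₀.length + 1 := by omega
      have h₂ : l₀.length + (l'.length + 1) - (l'.length + 1) = l₀.length := by omega
      funext j
      by_cases hj : j = t
      · subst hj
        simp [U, pushAll, hk, h₁, List.take_append, List.take_of_length_le]
      · by_cases hj' : j = k
        · subst hj'
          simp [U, pushAll, hj]
        · simp [U, pushAll, hj, hj'])
  have h₁ : U l = S := by
    funext j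
    by_cases hj : j = k
    · subst hj; simp [U, hS]
    · simp [U, hj]
  have h₂ : U [] = S' := by
    funext j
    by_cases hj : j = k
    · subst hj; simp [U, hS']
    · by_cases hj' : j = t
      · subst hj'; simp [U, hj, hT]
      · simp [U, hj, hj', hN j hj' hj]
  rw [h₁, h₂] at key
  exact key.mono (by omega)

end Prog

/-! ### Growth of the stacks -/

/-- A step executes one statement, which contains a bounded number of pushes. -/
theorem exists_length_stepAux_le {K : Type} [DecidableEq K] {Γ : K → Type} {Λ σ : Type}
    (q : TM2.Stmt Γ Λ σ) :
    ∃ c, ∀ v S k, ((TM2.stepAux q v S).stk k).length ≤ (S k).length + c := by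
  induction q with
  | push k f q ih =>
    obtain ⟨c, hc⟩ := ih
    refine ⟨c + 1, fun v S j => (hc v _ j).trans ?_⟩
    by_cases hj : j = k
    · subst hj; rw [Function.update_self, List.length_cons]; omega
    · rw [Function.update_of_ne hj]; omega
  | peek k f q ih =>
    obtain ⟨c, hc⟩ := ih
    exact ⟨c, fun v S j => hc _ _ j⟩
  | pop k f q ih =>
    obtain ⟨c, hc⟩ := ih
    refine ⟨c, fun v S j => (hc _ _ j).trans ?_⟩
    by_cases hj : j = k
    · subst hj; simp
    · simp [hj]
  | load a q ih =>
    obtain ⟨c, hc⟩ := ih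
    exact ⟨c, fun v S j => hc _ _ j⟩
  | branch p q r ih₁ ih₂ =>
    obtain ⟨c, hc⟩ := ih₁
    obtain ⟨d, hd⟩ := ih₂
    refine ⟨c + d, fun v S j => ?_⟩
    have h₁ := hc v S j
    have h₂ := hd v S j
    rw [TM2.stepAux]
    cases p v
    · exact h₂.trans (by omega)
    · exact h₁.trans (by omega)
  | goto l => exact ⟨0, fun v S j => le_rfl⟩
  | halt => exact ⟨0, fun v S j => le_rfl⟩

/-- There are finitely many statements, so one constant serves for all steps. This bounds the output
of a Turing machine by its input length and its running time. -/
theorem exists_length_le {K : Type} [DecidableEq K] {Γ : K → Type} {Λ σ : Type} [Fintype Λ]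
    (M : Λ → TM2.Stmt Γ Λ σ) :
    ∃ c, ∀ {n C D}, StepsIn (TM2.step M) C n D →
      ∀ k, (D.stk k).length ≤ (C.stk k).length + c * n := by
  choose c hc using fun l => exists_length_stepAux_le (M l)
  refine ⟨∑ l, c l, fun {n C D} h k => ?_⟩
  induction h with
  | refl => simp
  | @head C C' D m h₁ _ ih =>
    refine ih.trans ?_
    obtain ⟨_ | l, v, S⟩ := C
    · simp at h₁
    · simp only [TM2.step, Option.some.injEq] at h₁
      subst h₁
      have := hc l v S k
      have := Finset.single_le_sum (f := c) (fun _ _ => Nat.zero_le _) (Finset.mem_univ l)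
      simp only [Nat.mul_succ]
      omega

/-! ### Turing machines as machines -/

/-- The program of a Turing machine. -/
def ofTM (tm : FinTM2) : Prog tm.Γ where
  Λ := tm.Λ
  finΛ := tm.ΛFin
  σ := tm.σ
  finσ := tm.σFin
  main := tm.main
  start := tm.initialState
  m := tm.m

theorem initList_stk_self (tm : FinTM2) (s : List (tm.Γ tm.k₀)) :
    (initList tm s).stk tm.k₀ = s := by
  simp [initList]

theorem initList_stk_of_ne (tm : FinTM2) (s : List (tm.Γ tm.k₀)) {k : tm.K} (hk : k ≠ tm.k₀) :
    (initList tm s).stk k = [] := by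
  simp [initList, hk]

theorem haltList_stk_self (tm : FinTM2) (s : List (tm.Γ tm.k₁)) :
    (haltList tm s).stk tm.k₁ = s := by
  simp [haltList]

theorem haltList_stk_of_ne (tm : FinTM2) (s : List (tm.Γ tm.k₁)) {k : tm.K} (hk : k ≠ tm.k₁) :
    (haltList tm s).stk k = [] := by
  simp [haltList, hk]

/-- A string as a tuple of length one, written in symbols. -/
def single {T : Type} [Letter T] (l : List T) (_ : Unit) : List Symb := l.map Letter.toSymb

theorem len_single {T : Type} [Letter T] (l : List T) : len (single l) = l.length := by
  simp [len_unit, single]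

/-- Read a letter that belongs to the stack `k`. -/
def readSigma {K : Type} [DecidableEq K] {Γ : K → Type} (k : K) :
    Symb ⊕ (Σ k, Γ k) → Option (Γ k)
  | .inl _ => none
  | .inr x => if h : x.1 = k then some (h ▸ x.2) else none

theorem readSigma_inr {K : Type} [DecidableEq K] {Γ : K → Type} (k : K) (x : Γ k) :
    readSigma k (.inr ⟨k, x⟩) = some x := by
  simp [readSigma]

/-- A function that is computed by a Turing machine in polynomial time can be used in programs. -/
theorem polyTime_of_tm {α β A B : Type} [Letter A] [Letter B] {ea : α → List A} {eb : β → List B}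
    {f : α → β} (h : TM2ComputableInPolyTime ea eb f) :
    PolyTime (Σ k, h.tm.Γ k) (fun a => single (ea a)) (fun b => single (eb b)) f := by
  let tm := h.tm
  have : Fintype tm.K := tm.kFin
  obtain ⟨c, hc⟩ := exists_length_le (ofTM tm).m
  let E : StackEmbedding tm.Γ (fun _ : (Unit ⊕ tm.K) ⊕ (Unit ⊕ Unit) => Symb ⊕ (Σ k, tm.Γ k)) :=
    ⟨fun k => .inl (.inr k), fun a b hab => by simpa using hab, fun k x => .inr ⟨k, x⟩, readSigma,
      readSigma_inr⟩
  let X := Σ k, tm.Γ k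
  -- Input and output each pass through an auxiliary stack, since a single move reverses the string.
  let P : Prog (fun _ : (Unit ⊕ tm.K) ⊕ (Unit ⊕ Unit) => Symb ⊕ (Σ k, tm.Γ k)) :=
    ((Prog.move (.inr (.inl ())) (readLetter X A) (.inl (.inl ()))
      fun x => .inl (Letter.toSymb x)).seq
    (Prog.move (.inl (.inl ())) (readLetter X A) (.inl (.inr tm.k₀))
      fun x => .inr ⟨tm.k₀, h.inputAlphabet.symm x⟩)).seq (((ofTM tm).embed E).seq
    ((Prog.move (.inl (.inr tm.k₁)) (fun x => (readSigma tm.k₁ x).map h.outputAlphabet)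
      (.inl (.inl ())) fun x => .inl (Letter.toSymb x)).seq
    (Prog.move (.inl (.inl ())) (readLetter X B) (.inr (.inr ()))
      fun x => .inl (Letter.toSymb x))))
  have hlen : ∀ a, (eb (f a)).length ≤ (ea a).length + c * h.time.eval (ea a).length := by
    intro a
    obtain ⟨⟨t, ht⟩, htle⟩ := h.outputsFun a
    have h₁ := hc (StepsIn.iff_iterate.2 ht) tm.k₁
    rw [haltList_stk_self, List.length_map] at h₁
    have h₂ : ((initList tm ((ea a).map h.inputAlphabet.invFun)).stk tm.k₁).length ≤
        (ea a).length := by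
      -- Input and output stack may coincide; then the output stack is not empty at the start.
      by_cases hk : tm.k₁ = tm.k₀
      · rw [hk, initList_stk_self, List.length_map]
      · rw [initList_stk_of_ne _ _ hk]
        exact Nat.zero_le _
    exact h₁.trans (Nat.add_le_add h₂ (Nat.mul_le_mul_left c htle))
  -- Four moves, each with two steps per letter and two more: two for the input, two for the output
  -- of length at most `X + c * time`.
  refine ⟨⟨Unit ⊕ tm.K, P, 4 * Polynomial.X + 8 + h.time +
    4 * (Polynomial.X + (c : Polynomial ℕ) * h.time), fun a => ?_, fun a => ?_⟩⟩
  · obtain ⟨⟨t, ht⟩, htle⟩ := h.outputsFun a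
    have hrun : (ofTM tm).Runs (initList tm ((ea a).map h.inputAlphabet.invFun)).stk
        (h.time.eval (ea a).length) (haltList tm ((eb (f a)).map h.outputAlphabet.invFun)).stk :=
      ⟨t, htle, StepsIn.iff_iterate.2 ht⟩
    rw [len_single]
    let emp : Unit ⊕ Unit → List (Symb ⊕ (Σ k, tm.Γ k)) := fun _ => []
    let S₁ : (Unit ⊕ tm.K) ⊕ (Unit ⊕ Unit) → List (Symb ⊕ (Σ k, tm.Γ k)) := Sum.elim
      (Sum.elim (fun _ => ((ea a).map fun x => .inl (Letter.toSymb x)).reverse) fun _ => []) emp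
    let S₂ : (Unit ⊕ tm.K) ⊕ (Unit ⊕ Unit) → List (Symb ⊕ (Σ k, tm.Γ k)) := Sum.elim
      (Sum.elim (fun _ => []) fun k => ((initList tm ((ea a).map h.inputAlphabet.invFun)).stk k).map
        fun x => .inr ⟨k, x⟩) emp
    let S₃ : (Unit ⊕ tm.K) ⊕ (Unit ⊕ Unit) → List (Symb ⊕ (Σ k, tm.Γ k)) := Sum.elim
      (Sum.elim (fun _ => []) fun k =>
        ((haltList tm ((eb (f a)).map h.outputAlphabet.invFun)).stk k).map
          fun x => .inr ⟨k, x⟩) emp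
    let S₄ : (Unit ⊕ tm.K) ⊕ (Unit ⊕ Unit) → List (Symb ⊕ (Σ k, tm.Γ k)) := Sum.elim
      (Sum.elim (fun _ => ((eb (f a)).map fun x => .inl (Letter.toSymb x)).reverse) fun _ => []) emp
    have h₁ := Prog.runs_move (k := .inr (.inl ())) (t := .inl (.inl ())) (dec := readLetter X A)
      (w := fun x => .inl (Letter.toSymb x)) (enc := fun x => .inl (Letter.toSymb x))
      (S := ports X (single (ea a)) fun _ => []) (S' := S₁) (l := ea a)
      readLetter_inl (by simp) (by simp [ports, single]) rfl (by simp [S₁, ports])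
      (by rintro ((j | j) | (j | j)) hj hj' <;> first | rfl | contradiction)
    have h₂ := Prog.runs_move (k := .inl (.inl ())) (t := .inl (.inr tm.k₀)) (dec := readLetter X A)
      (w := fun x => .inr ⟨tm.k₀, h.inputAlphabet.symm x⟩) (enc := fun x => .inl (Letter.toSymb x))
      (S := S₁) (S' := S₂) (l := (ea a).reverse)
      readLetter_inl (by simp) (by simp [S₁]) rfl
      (by simp only [S₂, S₁, Sum.elim_inl, Sum.elim_inr]; rw [initList_stk_self]; simp [Function.comp_def])
      (by
        rintro ((j | j) | (j | j)) hj hj'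
        · contradiction
        · have : j ≠ tm.k₀ := fun hjk => hj (by rw [hjk])
          simp only [S₂, S₁, Sum.elim_inl, Sum.elim_inr]
          rw [initList_stk_of_ne _ _ this]
          rfl
        · rfl
        · rfl)
    have h₃ := hrun.embed (E := E) (T := S₂) (T' := S₃) (fun k => rfl) (fun k => rfl) (by
      rintro ((j | j) | (j | j))
      · exact .inl rfl
      · exact .inr ⟨j, rfl⟩
      · exact .inl rfl
      · exact .inl rfl)
    have h₄ := Prog.runs_move (k := .inl (.inr tm.k₁)) (t := .inl (.inl ()))
      (dec := fun x => (readSigma tm.k₁ x).map h.outputAlphabet)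
      (w := fun x => .inl (Letter.toSymb x)) (enc := fun x => .inr ⟨tm.k₁, h.outputAlphabet.symm x⟩)
      (S := S₃) (S' := S₄) (l := eb (f a))
      (fun x => by rw [readSigma_inr]; simp) (by simp)
      (by simp only [S₃, Sum.elim_inl, Sum.elim_inr]; rw [haltList_stk_self]; simp [Function.comp_def])
      rfl (by simp [S₃, S₄])
      (by
        rintro ((j | j) | (j | j)) hj hj'
        · contradiction
        · have : j ≠ tm.k₁ := fun hjk => hj' (by rw [hjk])
          simp only [S₃, S₄, Sum.elim_inl, Sum.elim_inr]
          rw [haltList_stk_of_ne _ _ this]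
          rfl
        · rfl
        · rfl)
    have h₅ := Prog.runs_move (k := .inl (.inl ())) (t := .inr (.inr ())) (dec := readLetter X B)
      (w := fun x => .inl (Letter.toSymb x)) (enc := fun x => .inl (Letter.toSymb x))
      (S := S₄) (S' := ports X (fun _ => []) (single (eb (f a)))) (l := (eb (f a)).reverse)
      readLetter_inl (by simp) (by simp [S₄]) rfl (by simp [S₄, ports, single, emp])
      (by rintro ((j | j) | (j | j)) hj hj' <;> first | rfl | contradiction)
    refine ((h₁.seq h₂).seq (h₃.seq (h₄.seq h₅))).mono ?_
    have := hlen a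
    simp only [List.length_reverse, Polynomial.eval_add, Polynomial.eval_mul, Polynomial.eval_X,
      Polynomial.eval_natCast, Polynomial.eval_ofNat, Nat.cast_id]
    omega
  · rw [len_single, len_single]
    have := hlen a
    simp only [Polynomial.eval_add, Polynomial.eval_mul, Polynomial.eval_X,
      Polynomial.eval_natCast, Polynomial.eval_ofNat, Nat.cast_id]
    omega

/-- Machines can be turned into Turing machines. -/
theorem polyTimeComputable_of_polyTime {X α β A B : Type} [Letter A] [Letter B] {ea : α → List A}
    {eb : β → List B} {f : α → β}
    (h : PolyTime X (fun a => single (ea a)) (fun b => single (eb b)) f) :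
    PolyTimeComputable ea eb f := by
  obtain ⟨M⟩ := h
  -- The outer input and output stacks carry the alphabets `A` and `B` themselves. Only the input
  -- alphabet has to be finite, so `X` is arbitrary.
  let Γ : (Unit ⊕ Unit) ⊕ (Unit ⊕ (M.W ⊕ (Unit ⊕ Unit))) → Type :=
    Sum.elim (Sum.elim (fun _ => A) fun _ => B) fun _ => Symb ⊕ X
  let E : StackEmbedding (fun _ : M.W ⊕ (Unit ⊕ Unit) => Symb ⊕ X) Γ :=
    ⟨fun k => .inr (.inr k), fun a b hab => by simpa using hab, fun k x => x, fun k x => some x,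
      fun _ _ => rfl⟩
  let P : Prog Γ :=
    ((Prog.move (Γ := Γ) (T := A) (.inl (.inl ())) some (.inr (.inl ()))
      fun x => (.inl (Letter.toSymb x) : Symb ⊕ X)).seq
    (Prog.move (Γ := Γ) (.inr (.inl ())) (readLetter X A) (.inr (.inr (.inr (.inl ()))))
      fun x => (.inl (Letter.toSymb x) : Symb ⊕ X))).seq ((M.prog.embed E).seq
    ((Prog.move (Γ := Γ) (.inr (.inr (.inr (.inr ())))) (readLetter X B) (.inr (.inl ()))
      fun x => (.inl (Letter.toSymb x) : Symb ⊕ X)).seq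
    (Prog.move (Γ := Γ) (T := B) (.inr (.inl ())) (readLetter X B) (.inl (.inr ())) fun x => x)))
  let tm : FinTM2 :=
    { K := (Unit ⊕ Unit) ⊕ (Unit ⊕ (M.W ⊕ (Unit ⊕ Unit)))
      k₀ := .inl (.inl ())
      k₁ := .inl (.inr ())
      Γ := Γ
      Λ := P.Λ
      main := P.main
      σ := P.σ
      initialState := P.start
      Γk₀Fin := (inferInstance : Fintype A)
      m := P.m }
  refine ⟨⟨⟨tm, Equiv.refl A, Equiv.refl B⟩, 4 * Polynomial.X + 8 + M.time + 4 * M.time,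
    fun a => Classical.choice ?_⟩⟩
  have hrev : ∀ {C D : Type} (w : C → D) (l : List C),
      l.map w = (l.reverse.map w).reverse ++ [] := by simp
  let T (x : List A) (y : List (Symb ⊕ X)) (S : M.W ⊕ (Unit ⊕ Unit) → List (Symb ⊕ X))
      (z : List B) : ∀ k, List (Γ k)
    | .inl (.inl _) => x
    | .inl (.inr _) => z
    | .inr (.inl _) => y
    | .inr (.inr k) => S k
  let emp : M.W ⊕ (Unit ⊕ Unit) → List (Symb ⊕ X) := fun _ => []
  have h₁ := Prog.runs_move (Γ := Γ) (T := A) (k := .inl (.inl ())) (t := .inr (.inl ()))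
    (dec := some) (w := fun x => (.inl (Letter.toSymb x) : Symb ⊕ X)) (enc := fun x => x)
    (S := T (ea a) [] emp []) (l := ea a)
    (S' := T [] ((ea a).map fun x => (.inl (Letter.toSymb x) : Symb ⊕ X)).reverse emp [])
    (fun _ => rfl) (by simp) (List.map_id _).symm rfl (List.append_nil _).symm
    (by rintro ((j | j) | (j | j)) hj hj' <;> first | rfl | contradiction)
  have h₂ := Prog.runs_move (Γ := Γ) (T := A) (k := .inr (.inl ()))
    (t := .inr (.inr (.inr (.inl ()))))
    (dec := readLetter X A) (w := fun x => (.inl (Letter.toSymb x) : Symb ⊕ X))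
    (enc := fun x => (.inl (Letter.toSymb x) : Symb ⊕ X))
    (S := T [] ((ea a).map fun x => (.inl (Letter.toSymb x) : Symb ⊕ X)).reverse emp [])
    (l := (ea a).reverse)
    (S' := T [] [] (ports X (single (ea a)) fun _ => []) [])
    readLetter_inl (by simp) List.map_reverse.symm rfl
    ((List.map_map ..).trans (hrev _ _))
    (by rintro ((j | j) | (j | (j | (j | j)))) hj hj' <;> first | rfl | contradiction)
  have h₃ := (M.runs a).embed (E := E) (T := T [] [] (ports X (single (ea a)) fun _ => []) [])
    (T' := T [] [] (ports X (fun _ => []) (single (eb (f a)))) [])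
    (fun k => (List.map_id _).symm) (fun k => (List.map_id _).symm) (by
      rintro ((j | j) | (j | j))
      · exact .inl rfl
      · exact .inl rfl
      · exact .inl rfl
      · exact .inr ⟨j, rfl⟩)
  have h₄ := Prog.runs_move (Γ := Γ) (T := B) (k := .inr (.inr (.inr (.inr ()))))
    (t := .inr (.inl ()))
    (dec := readLetter X B) (w := fun x => (.inl (Letter.toSymb x) : Symb ⊕ X))
    (enc := fun x => (.inl (Letter.toSymb x) : Symb ⊕ X))
    (S := T [] [] (ports X (fun _ => []) (single (eb (f a)))) [])
    (S' := T [] ((eb (f a)).map fun x => (.inl (Letter.toSymb x) : Symb ⊕ X)).reverse emp [])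
    (l := eb (f a))
    readLetter_inl (by simp) (List.map_map ..) rfl (List.append_nil _).symm
    (by rintro ((j | j) | (j | (j | (j | j)))) hj hj' <;> first | rfl | contradiction)
  have h₅ := Prog.runs_move (Γ := Γ) (T := B) (k := .inr (.inl ())) (t := .inl (.inr ()))
    (dec := readLetter X B) (w := fun x => x)
    (enc := fun x => (.inl (Letter.toSymb x) : Symb ⊕ X))
    (S := T [] ((eb (f a)).map fun x => (.inl (Letter.toSymb x) : Symb ⊕ X)).reverse emp [])
    (l := (eb (f a)).reverse) (S' := T [] [] emp (eb (f a)))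
    readLetter_inl (by simp) List.map_reverse.symm rfl ((List.map_id _).symm.trans (hrev _ _))
    (by rintro ((j | j) | (j | (j | (j | j)))) hj hj' <;> first | rfl | contradiction)
  obtain ⟨t, ht, hrun⟩ := (h₁.seq h₂).seq (h₃.seq (h₄.seq h₅))
  have hi : (initList tm ((ea a).map (Equiv.refl A).invFun)) =
      ⟨some P.main, P.start, T (ea a) [] emp []⟩ := by
    unfold initList
    congr 1
    funext k
    rcases k with ((k | k) | (k | k))
    · exact List.map_id _
    · rfl
    · rfl
    · rfl
  have ho : (haltList tm ((eb (f a)).map (Equiv.refl B).invFun)) =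
      ⟨none, P.start, T [] [] emp (eb (f a))⟩ := by
    unfold haltList
    congr 1
    funext k
    rcases k with ((k | k) | (k | k))
    · rfl
    · exact List.map_id _
    · rfl
    · rfl
  refine ⟨⟨⟨t, ?_⟩, ht.trans ?_⟩⟩
  · rw [Option.map_some, hi, ho]
    exact StepsIn.iff_iterate.1 hrun
  · have := M.len_le a
    simp only [len_single] at this ⊢
    simp only [List.length_reverse, Polynomial.eval_add, Polynomial.eval_mul, Polynomial.eval_X,
      Polynomial.eval_ofNat]
    omega

end StackMachine

end

noncomputable section

/-! ### Binary numerals -/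

namespace StackMachine

open BoolFormula Computability

/-- The value of a binary numeral, least significant bit first, that may have leading zeros. -/
def binVal : List Bool → ℕ
  | [] => 0
  | b :: l => b.toNat + 2 * binVal l

theorem binVal_eq_head_tail (l : List Bool) :
    binVal l = (l.headD false).toNat + 2 * binVal l.tail := by
  cases l <;> rfl

theorem binVal_encodePosNum (p : PosNum) : binVal (encodePosNum p) = p := by
  induction p with
  | one => rfl
  | bit0 p ih =>
    rw [encodePosNum, binVal, ih, PosNum.cast_bit0]
    simp
    omega
  | bit1 p ih =>
    rw [encodePosNum, binVal, ih, PosNum.cast_bit1]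
    simp
    omega

theorem binVal_encodeNat (n : ℕ) : binVal (encodeNat n) = n := by
  conv_rhs => rw [← Num.to_of_nat n]
  unfold encodeNat
  cases (n : Num) with
  | zero => rfl
  | pos p => exact binVal_encodePosNum p

/-- The map from `n` to `2 * n + 1` pushes one letter onto the numeral; new variables get their
indices in this way, without any arithmetic. -/
theorem encodeNat_bit1 (n : ℕ) : encodeNat (2 * n + 1) = true :: encodeNat n := by
  unfold encodeNat
  have : ((2 * n + 1 : ℕ) : Num) = Num.bit1 n := by
    apply Num.to_nat_inj.1
    rw [Num.to_of_nat, Num.cast_bit1, Num.to_of_nat]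
  rw [this]
  cases (n : Num) <;> rfl

theorem lt_two_pow_length_encodeNat (n : ℕ) : n < 2 ^ (encodeNat n).length := by
  conv_lhs => rw [← binVal_encodeNat n]
  generalize encodeNat n = l
  induction l with
  | nil => simp [binVal]
  | cons b l ih =>
    rw [binVal, List.length_cons, pow_succ]
    have := Bool.toNat_le b
    omega

/-- One step of a test of `x + y = z`: the state consists of the result of the test so far, the
carry, and the rests of the three numerals. -/
def sumEqStep (p : Bool × Bool × List Bool × List Bool × List Bool) :
    Bool × Bool × List Bool × List Bool × List Bool :=
  (p.1 && (p.2.2.2.2.headD false == ((p.2.2.1.headD false ^^ p.2.2.2.1.headD false) ^^ p.2.1)),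
    (p.2.2.1.headD false && p.2.2.2.1.headD false ||
      p.2.1 && (p.2.2.1.headD false ^^ p.2.2.2.1.headD false)),
    p.2.2.1.tail, p.2.2.2.1.tail, p.2.2.2.2.tail)

/-- The state of the test of `x + y = z` after as many steps as `k` has letters. -/
def sumEqState (x y z k : List Bool) : Bool × Bool × List Bool × List Bool × List Bool :=
  k.foldr (fun _ => sumEqStep) (true, false, x, y, z)

/-- The test of `x + y = z` for binary numerals. -/
def sumEq (x y z : List Bool) : Bool :=
  (sumEqState x y z (x ++ y ++ z)).1 && !(sumEqState x y z (x ++ y ++ z)).2.1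

/-- Invariant of written addition: no mismatch so far, and the remaining numerals with the carry
satisfy the equation. A step strips the lowest bits, which must agree in parity. -/
theorem sumEqState_spec (x y z k : List Bool) :
    (sumEqState x y z k).2.2 = (x.drop k.length, y.drop k.length, z.drop k.length) ∧
    (((sumEqState x y z k).1 = true ∧ binVal (sumEqState x y z k).2.2.1 +
      binVal (sumEqState x y z k).2.2.2.1 + (sumEqState x y z k).2.1.toNat =
        binVal (sumEqState x y z k).2.2.2.2) ↔ binVal x + binVal y = binVal z) := by
  induction k with
  | nil => simp [sumEqState]
  | cons b k ih =>
    have h : sumEqState x y z (b :: k) = sumEqStep (sumEqState x y z k) := rfl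
    rw [h]
    obtain ⟨h₁, h₂⟩ := ih
    constructor
    · simp [sumEqStep, h₁]
    · rw [← h₂]
      generalize sumEqState x y z k = p
      obtain ⟨ok, c, x, y, z⟩ := p
      simp only [sumEqStep]
      rw [binVal_eq_head_tail x, binVal_eq_head_tail y, binVal_eq_head_tail z]
      generalize x.headD false = a
      generalize y.headD false = b
      generalize z.headD false = d
      cases ok <;> cases a <;> cases b <;> cases c <;> cases d <;> simp <;> omega

/-- The string `x ++ y ++ z` is a counter, long enough to exhaust all three numerals; then the
remaining equation says that the carry is zero. -/
theorem sumEq_eq (x y z : List Bool) : sumEq x y z = decide (binVal x + binVal y = binVal z) := by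
  obtain ⟨h₁, h₂⟩ := sumEqState_spec x y z (x ++ y ++ z)
  rw [h₁] at h₂
  have hx : x.drop (x ++ y ++ z).length = [] := List.drop_eq_nil_of_le (by simp)
  have hy : y.drop (x ++ y ++ z).length = [] := List.drop_eq_nil_of_le (by simp; omega)
  have hz : z.drop (x ++ y ++ z).length = [] := List.drop_eq_nil_of_le (by simp; omega)
  rw [hx, hy, hz] at h₂
  rw [Bool.eq_iff_iff, decide_eq_true_iff, ← h₂, sumEq]
  simp [binVal]

/-- The state after cutting off as many low bits of `l` as `u` has letters. -/
def splitState (u : List Symb) (l : List Bool) : List Bool × List Bool :=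
  u.foldr (fun _ p => (p.1.tail, p.1.headD false :: p.2)) (l, [])

/-- The low bits of a numeral, as many as `u` has letters. -/
def lowBits (u : List Symb) (l : List Bool) : List Bool := (splitState u l).2.reverse

/-- The numeral that remains when the low bits are cut off. -/
def highBits (u : List Symb) (l : List Bool) : List Bool := (splitState u l).1

theorem binVal_append (l m : List Bool) : binVal (l ++ m) = binVal l + 2 ^ l.length * binVal m := by
  induction l with
  | nil => simp [binVal]
  | cons b l ih =>
    rw [List.cons_append, binVal, ih, binVal, List.length_cons, pow_succ]
    ring

theorem binVal_lt (l : List Bool) : binVal l < 2 ^ l.length := by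
  induction l with
  | nil => simp [binVal]
  | cons b l ih =>
    rw [binVal, List.length_cons, pow_succ]
    have := Bool.toNat_le b
    omega

theorem length_lowBits (u : List Symb) (l : List Bool) : (lowBits u l).length = u.length := by
  rw [lowBits, List.length_reverse]
  induction u with
  | nil => rfl
  | cons x u ih => simpa [splitState] using ih

/-- Division with remainder by `2 ^ u.length`: the low part has exactly `u.length` bits, zeros being
supplied when `l` is too short. -/
theorem binVal_lowBits_add (u : List Symb) (l : List Bool) :
    binVal (lowBits u l) + 2 ^ u.length * binVal (highBits u l) = binVal l := by
  induction u with
  | nil => simp [lowBits, highBits, splitState, binVal]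
  | cons x u ih =>
    have h : splitState (x :: u) l = ((splitState u l).1.tail,
      (splitState u l).1.headD false :: (splitState u l).2) := rfl
    have hl := length_lowBits u l
    rw [← ih]
    unfold lowBits highBits at *
    rw [h, binVal_eq_head_tail (splitState u l).1, List.reverse_cons, binVal_append, hl,
      List.length_cons, pow_succ]
    simp only [binVal]
    ring

theorem binVal_lowBits (u : List Symb) (l : List Bool) :
    binVal (lowBits u l) = binVal l % 2 ^ u.length := by
  have h := binVal_lt (lowBits u l)
  rw [length_lowBits] at h
  rw [← binVal_lowBits_add u l, Nat.add_mul_mod_self_left, Nat.mod_eq_of_lt h]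

theorem binVal_highBits (u : List Symb) (l : List Bool) :
    binVal (highBits u l) = binVal l / 2 ^ u.length := by
  have h := binVal_lt (lowBits u l)
  rw [length_lowBits] at h
  rw [← binVal_lowBits_add u l, Nat.add_mul_div_left _ _ (by positivity), Nat.div_eq_of_lt h,
    Nat.zero_add]

/-! ### Polynomial-time operations on numerals -/

section

variable {X α : Type} [Data α]

@[fun_prop]
theorem PT.sumEq {f g h : α → List Bool} (hf : PT X f) (hg : PT X g) (hh : PT X h) :
    PT X (fun a => sumEq (f a) (g a) (h a)) := by
  have hs : PT X sumEqStep := by unfold sumEqStep; fun_prop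
  have : PT X (fun p : List Bool × List Bool × List Bool × List Bool =>
      sumEqState p.1 p.2.1 p.2.2.1 p.2.2.2) := by
    refine PT.foldr_of_le (s := fun _ => sumEqStep) (fun _ => hs) (by fun_prop) (by fun_prop) 0
      fun _ p => ?_
    simp [sumEqStep]
    omega
  have h' : PT X (fun a => sumEqState (f a) (g a) (h a) (f a ++ g a ++ h a)) :=
    this.comp (f := fun a => (f a, g a, h a, f a ++ g a ++ h a)) (by fun_prop)
  unfold StackMachine.sumEq
  fun_prop

theorem PT.splitState {f : α → List Symb} {g : α → List Bool} (hf : PT X f) (hg : PT X g) :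
    PT X (fun a => splitState (f a) (g a)) := by
  refine PT.foldr_of_le (s := fun (_ : Symb) (p : List Bool × List Bool) =>
    (p.1.tail, p.1.headD false :: p.2)) (fun _ => by fun_prop) (by fun_prop) hf 1 fun _ p => ?_
  simp
  omega

@[fun_prop]
theorem PT.lowBits {f : α → List Symb} {g : α → List Bool} (hf : PT X f) (hg : PT X g) :
    PT X (fun a => lowBits (f a) (g a)) :=
  (PT.splitState hf hg).snd.reverse

@[fun_prop]
theorem PT.highBits {f : α → List Symb} {g : α → List Bool} (hf : PT X f) (hg : PT X g) :
    PT X (fun a => highBits (f a) (g a)) :=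
  (PT.splitState hf hg).fst

@[fun_prop]
theorem PT.bit1 {f : α → ℕ} (hf : PT X f) : PT X (fun a => 2 * f a + 1) := by
  apply PT.of_encodeNat
  simp only [encodeNat_bit1]
  fun_prop

end

end StackMachine

/-! ### Operations on formulas -/

namespace BoolFormula

open StackMachine Computability

/-- The first variable of a formula. -/
def firstVar : BoolFormula → Option ℕ
  | const _ => none
  | var i => some i
  | neg F => F.firstVar
  | conj F G => F.firstVar.or G.firstVar
  | disj F G => F.firstVar.or G.firstVar

/-- Replace a variable by a constant. -/
def subst (i : ℕ) (b : Bool) : BoolFormula → BoolFormula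
  | const c => const c
  | var j => if j = i then const b else var j
  | neg F => neg (F.subst i b)
  | conj F G => conj (F.subst i b) (G.subst i b)
  | disj F G => disj (F.subst i b) (G.subst i b)

theorem foldr_map_bit {β : Type} (l m : List Bool) (b : β) (s : Symb → List Bool × β → List Bool × β)
    (hs : ∀ c p, s (.bit c) p = (c :: p.1, p.2)) :
    (l.map Symb.bit).foldr s (m, b) = (l ++ m, b) := by
  induction l with
  | nil => rfl
  | cons c l ih => simp [ih, hs]

/-- A step of the search for the first variable, when the string of a formula is read from right
to left. -/
def firstVarStep : Symb → List Bool × List Bool × Bool → List Bool × List Bool × Bool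
  | .bit b, p => (b :: p.1, p.2)
  | .varOpen, p => ([], p.1, true)
  | _, p => p

/-- Every variable overwrites the result of those to its right, so the leftmost one remains. `r` is
what was found to the right of `F`. -/
theorem foldr_firstVarStep (F : BoolFormula) (r : List Bool × Bool) :
    F.encode.foldr firstVarStep ([], r) =
      ([], F.firstVar.elim r fun i => (encodeNat i, true)) := by
  induction F generalizing r with
  | const b => rfl
  | var i =>
    simp only [encode, List.cons_append, List.foldr_cons, List.foldr_append, List.foldr_nil]
    rw [show firstVarStep .varClose ([], r) = ([], r) from rfl,
      foldr_map_bit _ _ _ _ fun _ _ => rfl]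
    simp [firstVarStep, firstVar]
  | neg F ih => simp [encode, ih, firstVarStep, firstVar]
  | conj F G ih₁ ih₂ | disj F G ih₁ ih₂ =>
    simp only [encode, List.foldr_cons, List.foldr_append, ih₁, ih₂, firstVar]
    cases F.firstVar <;> rfl

/-- A step of the substitution of a constant for a variable, when the string of a formula is read
from right to left. The state consists of the bits of the current variable, the output, and the
numeral of the variable that is replaced. -/
def substStep (b : Bool) : Symb → List Bool × List Symb × List Bool → List Bool × List Symb × List Bool
  | .bit c, p => (c :: p.1, p.2)
  | .varOpen, p => ([], bif sumEq p.1 [] p.2.2 then .const b :: p.2.1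
      else .varOpen :: (p.1.map .bit ++ .varClose :: p.2.1), p.2.2)
  | .varClose, p => p
  | .const c, p => (p.1, .const c :: p.2.1, p.2.2)
  | .neg, p => (p.1, .neg :: p.2.1, p.2.2)
  | .conj, p => (p.1, .conj :: p.2.1, p.2.2)
  | .disj, p => (p.1, .disj :: p.2.1, p.2.2)

/-- `s` is the output for what stands to the right of `F`. With the empty numeral as a summand,
`sumEq` tests the equality of two indices. -/
theorem foldr_substStep (F : BoolFormula) (i : ℕ) (b : Bool) (s : List Symb) :
    F.encode.foldr (substStep b) ([], s, encodeNat i) =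
      ([], (F.subst i b).encode ++ s, encodeNat i) := by
  induction F generalizing s with
  | const b => rfl
  | var j =>
    simp only [encode, List.cons_append, List.foldr_cons, List.foldr_append, List.foldr_nil]
    rw [show substStep b .varClose ([], s, encodeNat i) = ([], s, encodeNat i) from rfl,
      foldr_map_bit _ _ _ _ fun _ _ => rfl]
    simp only [List.append_nil, substStep, sumEq_eq, binVal_encodeNat, subst, binVal, Nat.add_zero]
    by_cases h : j = i <;> simp [h, encode]
  | neg F ih => simp [encode, ih, substStep, subst]
  | conj F G ih₁ ih₂ | disj F G ih₁ ih₂ => simp [encode, ih₁, ih₂, substStep, subst]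

/-- A step of the evaluation of a formula without variables, when its string is read from right to
left. -/
def evalStep : Symb → List Bool → List Bool
  | .const b, l => b :: l
  | .neg, l => (!l.headD false) :: l.tail
  | .conj, l => (l.headD false && l.tail.headD false) :: l.tail.tail
  | .disj, l => (l.headD false || l.tail.headD false) :: l.tail.tail
  | _, l => l

/-- From right to left, prefix notation is evaluated with a stack: the operands are on top, the left
one first, when their connective is read. -/
theorem foldr_evalStep (F : BoolFormula) (hF : F.vars = ∅) (v : ℕ → Bool) (l : List Bool) :
    F.encode.foldr evalStep l = F.eval v :: l := by
  induction F generalizing l with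
  | const b => rfl
  | var j => simp [vars] at hF
  | neg F ih => simp [encode, ih hF, evalStep, eval]
  | conj F G ih₁ ih₂ | disj F G ih₁ ih₂ =>
    rw [vars, Finset.union_eq_empty] at hF
    simp [encode, ih₁ hF.1, ih₂ hF.2, evalStep, eval]

/-- The truth value of a formula without variables. -/
def evalClosed (F : BoolFormula) : Bool := (F.encode.foldr evalStep []).headD false

theorem evalClosed_eq (F : BoolFormula) (hF : F.vars = ∅) (v : ℕ → Bool) :
    F.evalClosed = F.eval v := by
  rw [evalClosed, foldr_evalStep F hF v]
  rfl

/-- Extend a conjunction of variables by a new variable; the state consists of a number that is at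
least as large as all of them, and the conjunction. -/
def freshStep (p : ℕ × BoolFormula) : ℕ × BoolFormula :=
  (2 * p.1 + 1, conj (var (2 * p.1 + 1)) p.2)

/-- A number that exceeds the variables of all formulas of the length of `u`. -/
def freshBase (u : List Symb) : ℕ := u.foldr (fun _ n => 2 * n + 1) 0

/-- A conjunction of new variables, as many as `u` has letters. -/
def fresh (u : List Symb) : ℕ × BoolFormula :=
  u.foldr (fun _ => freshStep) (freshBase u, const true)

end BoolFormula

/-! ### Polynomial-time operations on formulas -/

namespace StackMachine

open BoolFormula Computability

variable {X α : Type} [Data α]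

theorem PT.firstVarState {f : α → BoolFormula} (hf : PT X f) :
    PT X (fun a => (f a).encode.foldr firstVarStep ([], [], false)) := by
  refine PT.foldr_of_le (fun x => ?_) (by fun_prop) (by fun_prop) 1 fun x p => ?_
  · cases x <;> unfold firstVarStep <;> fun_prop
  · cases x <;> simp [firstVarStep] <;> omega

@[fun_prop]
theorem PT.firstVar_isSome {f : α → BoolFormula} (hf : PT X f) :
    PT X (fun a => (f a).firstVar.isSome) :=
  (PT.firstVarState hf).snd.snd.of_eq fun a => by
    rw [foldr_firstVarStep]
    cases (f a).firstVar <;> rfl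

@[fun_prop]
theorem PT.firstVar_getD {f : α → BoolFormula} (hf : PT X f) :
    PT X (fun a => (f a).firstVar.getD 0) :=
  PT.of_encodeNat <| (PT.firstVarState hf).snd.fst.of_eq fun a => by
    rw [foldr_firstVarStep]
    cases (f a).firstVar <;> rfl

@[fun_prop]
theorem PT.subst {f : α → BoolFormula} {g : α → ℕ} (hf : PT X f) (hg : PT X g) (b : Bool) :
    PT X (fun a => (f a).subst (g a) b) := by
  have : PT X (fun a => (f a).encode.foldr (substStep b) ([], [], Computability.encodeNat (g a))) := by
    -- The bits of a variable that is kept move from the buffer to the output; only its two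
    -- delimiters are new, hence the constant `2`.
    refine PT.foldr_of_le (fun x => ?_) (by fun_prop) (by fun_prop) 2 fun x p => ?_
    · cases x <;> unfold substStep <;> fun_prop
    · cases x with
      | varOpen =>
        simp only [substStep]
        cases StackMachine.sumEq p.1 [] p.2.2 <;> simp <;> omega
      | _ => simp [substStep] <;> omega
  refine PT.of_encode (this.snd.fst.of_eq fun a => ?_)
  rw [foldr_substStep, List.append_nil]

@[fun_prop]
theorem PT.evalClosed {f : α → BoolFormula} (hf : PT X f) : PT X (fun a => (f a).evalClosed) := by
  have : PT X (fun a => (f a).encode.foldr evalStep []) := by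
    refine PT.foldr_of_le (fun x => ?_) (by fun_prop) (by fun_prop) 1 fun x p => ?_
    · cases x <;> unfold evalStep <;> fun_prop
    · cases x <;> simp [evalStep] <;> omega
  exact this.headD false

theorem PT.freshBase {f : α → List Symb} (hf : PT X f) : PT X (fun a => freshBase (f a)) := by
  refine PT.foldr_of_le (s := fun (_ : Symb) n => 2 * n + 1) (fun x => by fun_prop) (by fun_prop)
    hf 1 fun x p => ?_
  rw [size_nat, size_nat, encodeNat_bit1, List.length_cons]

theorem PT.fresh {f : α → List Symb} (hf : PT X f) : PT X (fun a => fresh (f a)) := by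
  have hs : PT X freshStep := by unfold freshStep; fun_prop
  have hb := PT.freshBase hf
  refine PT.foldr (s := fun (_ : Symb) => freshStep) (fun _ => hs)
    (g := fun a => (BoolFormula.freshBase (f a), BoolFormula.const true)) (by fun_prop) hf
    (Polynomial.X * (2 * Polynomial.X + 5) + 2 * Polynomial.X) fun a l hl => ?_
  -- Each new variable contributes a connective, two delimiters and a numeral one bit longer than
  -- the previous one, so the length is quadratic.
  have h : ∀ l : List Symb,
      size (l.foldr (fun _ => freshStep) (BoolFormula.freshBase (f a), BoolFormula.const true)).1 =
        size (BoolFormula.freshBase (f a)) + l.length ∧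
      size (l.foldr (fun _ => freshStep) (BoolFormula.freshBase (f a), BoolFormula.const true)).2 ≤
        1 + l.length * (size (BoolFormula.freshBase (f a)) + l.length + 4) := by
    intro l
    induction l with
    | nil => simp [BoolFormula.encode]
    | cons x l ih =>
      rw [List.foldr_cons]
      generalize l.foldr (fun _ => freshStep) (BoolFormula.freshBase (f a), BoolFormula.const true) = p at ih
      simp only [size_nat, size_formula, freshStep, encodeNat_bit1, List.length_cons,
        BoolFormula.encode,
        List.length_append, List.length_map, List.length_nil] at ih ⊢
      refine ⟨by omega, ?_⟩
      nlinarith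
  have h₁ := h l
  have h₂ := hl.length_le
  rw [size_prod, size_prod]
  have h₃ : size (BoolFormula.const true) = 1 := rfl
  simp only [h₃, Polynomial.eval_add, Polynomial.eval_mul, Polynomial.eval_X,
    Polynomial.eval_ofNat]
  generalize size (BoolFormula.freshBase (f a)) = n at *
  have h₄ := Nat.mul_le_mul h₂ (Nat.add_le_add_right (Nat.add_le_add_left h₂ n) 4)
  have h₅ : (f a).length * (n + (f a).length + 4) ≤
      (n + 1 + (f a).length) * (2 * (n + 1 + (f a).length) + 5) :=
    Nat.mul_le_mul (by omega) (by omega)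
  omega

end StackMachine

end

noncomputable section

namespace BoolFormula

open StackMachine Computability

/-! ### Counting satisfying assignments -/

theorem eval_congr {F : BoolFormula} {v w : ℕ → Bool} (h : ∀ i ∈ F.vars, v i = w i) :
    F.eval v = F.eval w := by
  induction F with
  | const b => rfl
  | var i => exact h i (by simp [vars])
  | neg F ih => rw [eval, eval, ih h]
  | conj F G ih₁ ih₂ | disj F G ih₁ ih₂ =>
    rw [eval, eval, ih₁ fun i hi => h i (Finset.mem_union_left _ hi),
      ih₂ fun i hi => h i (Finset.mem_union_right _ hi)]

/-- The truth value of a formula when exactly the variables in `T` are true. -/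
def evalSet (F : BoolFormula) (T : Finset ℕ) : Bool := F.eval fun i => decide (i ∈ T)

/-- Assignments become sets of true variables, so that counts can be split by adjoining one element
to subsets. -/
theorem sharpSAT_eq_sum (F : BoolFormula) :
    F.sharpSAT = ∑ T ∈ F.vars.powerset, (F.evalSet T).toNat := by
  have h : ∀ T, (F.evalSet T).toNat = if F.evalSet T = true then 1 else 0 := fun T => by
    cases F.evalSet T <;> rfl
  simp only [h]
  rw [← Finset.card_filter, sharpSAT, Fintype.card_subtype]
  refine Finset.card_nbij' (fun a => F.vars.filter fun i => ∃ h : i ∈ F.vars, a ⟨i, h⟩ = true)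
    (fun T i => decide (i.1 ∈ T)) ?_ ?_ ?_ ?_
  · intro a ha
    simp only [Finset.coe_filter, Finset.mem_univ, true_and, Set.mem_ofPred_eq] at ha
    simp only [Finset.coe_filter, Finset.mem_powerset, Set.mem_ofPred_eq]
    refine ⟨Finset.filter_subset _ _, ?_⟩
    refine Eq.trans ?_ ha
    rw [evalSet, evalOn]
    refine eval_congr fun i hi => ?_
    rw [Bool.eq_iff_iff]
    simp [hi]
  · intro T hT
    simp only [Finset.coe_filter, Finset.mem_powerset, Set.mem_ofPred_eq] at hT
    simp only [Finset.coe_filter, Finset.mem_univ, true_and, Set.mem_ofPred_eq]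
    refine Eq.trans ?_ hT.2
    rw [evalSet, evalOn]
    refine eval_congr fun i hi => ?_
    simp [hi]
  · intro a _
    funext i
    rw [Bool.eq_iff_iff]
    simp
  · intro T hT
    simp only [Finset.coe_filter, Finset.mem_powerset, Set.mem_ofPred_eq] at hT
    ext i
    simp only [Finset.mem_filter, decide_eq_true_eq]
    exact ⟨fun h => h.2.2, fun h => ⟨hT.1 h, hT.1 h, h⟩⟩

theorem sharpSAT_le (F : BoolFormula) : F.sharpSAT ≤ 2 ^ F.vars.card := by
  rw [sharpSAT_eq_sum, ← Finset.card_powerset, Finset.card_eq_sum_ones]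
  exact Finset.sum_le_sum fun T _ => Bool.toNat_le _

theorem sharpSAT_of_vars_eq_empty (F : BoolFormula) (hF : F.vars = ∅) :
    F.sharpSAT = F.evalClosed.toNat := by
  rw [sharpSAT_eq_sum, hF, Finset.powerset_empty, Finset.sum_singleton, evalSet,
    ← evalClosed_eq F hF]

theorem eval_subst (F : BoolFormula) (i : ℕ) (b : Bool) (v : ℕ → Bool) :
    (F.subst i b).eval v = F.eval (Function.update v i b) := by
  induction F with
  | const c => rfl
  | var j =>
    by_cases h : j = i
    · subst h; simp [subst, eval]
    · simp [subst, eval, h]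
  | neg F ih => rw [subst, eval, eval, ih]
  | conj F G ih₁ ih₂ | disj F G ih₁ ih₂ => rw [subst, eval, eval, ih₁, ih₂]

theorem vars_subst (F : BoolFormula) (i : ℕ) (b : Bool) : (F.subst i b).vars = F.vars.erase i := by
  induction F with
  | const c => rfl
  | var j =>
    by_cases h : j = i
    · subst h; simp [subst, vars]
    · simp [subst, vars, h, Finset.erase_eq_of_notMem, Ne.symm h]
  | neg F ih => exact ih
  | conj F G ih₁ ih₂ | disj F G ih₁ ih₂ =>
    rw [subst, vars, vars, ih₁, ih₂, Finset.erase_union_distrib]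

theorem evalSet_subst_true (F : BoolFormula) (i : ℕ) (T : Finset ℕ) :
    (F.subst i true).evalSet T = F.evalSet (insert i T) := by
  rw [evalSet, evalSet, eval_subst]
  congr 1
  funext j
  by_cases h : j = i
  · subst h; simp
  · simp [h]

theorem evalSet_subst_false (F : BoolFormula) {i : ℕ} {T : Finset ℕ} (hi : i ∉ T) :
    (F.subst i false).evalSet T = F.evalSet T := by
  rw [evalSet, evalSet, eval_subst]
  congr 1
  funext j
  by_cases h : j = i
  · subst h; simp [hi]
  · simp [h]

theorem sum_powerset_erase {V : Finset ℕ} {x : ℕ} (hx : x ∈ V) (f : Finset ℕ → ℕ) :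
    ∑ T ∈ V.powerset, f T =
      ∑ T ∈ (V.erase x).powerset, f T + ∑ T ∈ (V.erase x).powerset, f (insert x T) := by
  conv_lhs => rw [← Finset.insert_erase hx]
  exact Finset.sum_powerset_insert (Finset.notMem_erase x V) f

theorem notMem_of_mem_powerset_erase {V T : Finset ℕ} {x : ℕ} (hT : T ∈ (V.erase x).powerset) :
    x ∉ T := fun hx =>
  Finset.notMem_erase x V (Finset.mem_powerset.1 hT hx)

theorem sharpSAT_eq_add (F : BoolFormula) {x : ℕ} (hx : x ∈ F.vars) :
    F.sharpSAT = (F.subst x false).sharpSAT + (F.subst x true).sharpSAT := by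
  rw [sharpSAT_eq_sum, sharpSAT_eq_sum, sharpSAT_eq_sum, vars_subst, vars_subst,
    sum_powerset_erase hx]
  congr 1
  · exact Finset.sum_congr rfl fun T hT => by
      rw [evalSet_subst_false _ (notMem_of_mem_powerset_erase hT)]
  · exact Finset.sum_congr rfl fun T _ => by rw [evalSet_subst_true]

/-- Each variable without influence doubles the sum. -/
theorem sum_powerset_union (V W : Finset ℕ) (hVW : Disjoint V W) (f : Finset ℕ → ℕ)
    (hf : ∀ y ∈ W, ∀ T, f (insert y T) = f T) :
    ∑ T ∈ (V ∪ W).powerset, f T = 2 ^ W.card * ∑ T ∈ V.powerset, f T := by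
  induction W using Finset.induction_on with
  | empty => simp
  | insert y W hy ih =>
    rw [Finset.disjoint_insert_right] at hVW
    rw [Finset.union_insert, Finset.sum_powerset_insert (by simp [hy, hVW.1]),
      Finset.sum_congr rfl fun T _ => hf y (Finset.mem_insert_self y W) T,
      ih hVW.2 fun z hz => hf z (Finset.mem_insert_of_mem hz), Finset.card_insert_of_notMem hy]
    ring

theorem evalSet_insert (F : BoolFormula) {y : ℕ} (hy : y ∉ F.vars) (T : Finset ℕ) :
    F.evalSet (insert y T) = F.evalSet T :=
  eval_congr fun i hi => by
    have : i ≠ y := fun h => hy (h ▸ hi)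
    simp [this]

/-- A formula in whose number of satisfying assignments those of the two instances of `G` can be
read off when `Y` is a conjunction of sufficiently many new variables. -/
def combine (G : BoolFormula) (x : ℕ) (Y : BoolFormula) : BoolFormula := conj G (disj (var x) Y)

theorem vars_combine {G : BoolFormula} {x : ℕ} (hx : x ∈ G.vars) (Y : BoolFormula) :
    (combine G x Y).vars = G.vars ∪ Y.vars := by
  ext i
  simp only [combine, vars, Finset.mem_union, Finset.mem_singleton]
  constructor
  · rintro (h | rfl | h)
    exacts [.inl h, .inl hx, .inr h]
  · rintro (h | h)
    exacts [.inl h, .inr (.inr h)]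

/-- If `y` is false, then `x` must be true and the variables of `Y` are free, which gives the first
summand. If `y` is true, it drops out of the conjunction. -/
theorem sharpSAT_combine_conj {G Y : BoolFormula} {x y : ℕ} (hx : x ∈ G.vars)
    (hGY : Disjoint G.vars Y.vars) (hG : y ∉ G.vars) (hY : y ∉ Y.vars) :
    (combine G x (conj (var y) Y)).sharpSAT =
      2 ^ Y.vars.card * (G.subst x true).sharpSAT + (combine G x Y).sharpSAT := by
  have hxy : x ≠ y := fun h => hG (h ▸ hx)
  have hvars : (combine G x (conj (var y) Y)).vars = insert y (G.vars ∪ Y.vars) := by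
    rw [vars_combine hx, vars, vars, ← Finset.insert_eq, Finset.union_insert]
  rw [sharpSAT_eq_sum, hvars, Finset.sum_powerset_insert (by simp [hG, hY])]
  congr 1
  · have h₁ : ∀ T ∈ (G.vars ∪ Y.vars).powerset,
        ((combine G x (conj (var y) Y)).evalSet T).toNat =
          (G.evalSet T && decide (x ∈ T)).toNat := by
      intro T hT
      have : y ∉ T := fun h => by
        have := Finset.mem_powerset.1 hT h
        simp [hG, hY] at this
      simp [combine, evalSet, eval, this]
    have h₂ : ∀ T ∈ (G.vars.erase x).powerset, (G.evalSet T && decide (x ∈ T)).toNat = 0 := by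
      intro T hT
      simp [notMem_of_mem_powerset_erase hT]
    rw [Finset.sum_congr rfl h₁, sum_powerset_union _ _ hGY, sum_powerset_erase hx,
      Finset.sum_congr rfl h₂, sharpSAT_eq_sum, vars_subst, Finset.sum_const_zero, Nat.zero_add]
    · congr 1
      exact Finset.sum_congr rfl fun T _ => by rw [evalSet_subst_true]; simp
    · intro z hz T
      have hzG : z ∉ G.vars := fun h => Finset.disjoint_left.1 hGY h hz
      have hxz : x ≠ z := fun h => hzG (h ▸ hx)
      simp [evalSet_insert G hzG, hxz]
  · rw [sharpSAT_eq_sum, vars_combine hx]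
    refine Finset.sum_congr rfl fun T _ => ?_
    have h₁ := evalSet_insert G hG T
    have h₂ := evalSet_insert Y hY T
    unfold evalSet at h₁ h₂
    simp only [combine, evalSet, eval, h₁, h₂]
    simp [hxy]

/-- The numeral of a variable is part of the string of `F`, so its index is below `2 ^
F.encode.length`, which is `freshBase F.encode + 1`. -/
theorem le_freshBase (F : BoolFormula) : ∀ i ∈ F.vars, i ≤ freshBase F.encode := by
  have h₁ : ∀ u : List Symb, freshBase u + 1 = 2 ^ u.length := by
    intro u
    induction u with
    | nil => rfl
    | cons x u ih =>
      have : freshBase (x :: u) = 2 * freshBase u + 1 := rfl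
      rw [this, List.length_cons, pow_succ]
      omega
  have h₂ : ∀ i ∈ F.vars, i < 2 ^ F.encode.length := by
    induction F with
    | const b => simp [vars]
    | var j =>
      intro i hi
      rw [vars, Finset.mem_singleton] at hi
      subst hi
      refine (lt_two_pow_length_encodeNat i).trans_le (Nat.pow_le_pow_right (by norm_num) ?_)
      simp [encode]
      omega
    | neg F ih =>
      intro i hi
      refine (ih i hi).trans_le (Nat.pow_le_pow_right (by norm_num) ?_)
      simp [encode]
    | conj F G ih₁ ih₂ | disj F G ih₁ ih₂ =>
      intro i hi
      rcases Finset.mem_union.1 hi with hi | hi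
      · refine (ih₁ i hi).trans_le (Nat.pow_le_pow_right (by norm_num) ?_)
        simp [encode]
        omega
      · refine (ih₂ i hi).trans_le (Nat.pow_le_pow_right (by norm_num) ?_)
        simp [encode]
        omega
  intro i hi
  have := h₁ F.encode
  have := h₂ i hi
  omega

/-- Hence the length of `F` suffices both as the number of elimination steps and as the exponent
that keeps the two counts apart. -/
theorem card_vars_lt (F : BoolFormula) : F.vars.card < F.encode.length := by
  induction F with
  | const b => simp [vars, encode]
  | var i => simp [vars, encode]
  | neg F ih => rw [vars, encode, List.length_cons]; omega
  | conj F G ih₁ ih₂ | disj F G ih₁ ih₂ =>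
    have := Finset.card_union_le F.vars G.vars
    rw [vars, encode, List.length_cons, List.length_append]
    omega

theorem length_encode_subst_le (F : BoolFormula) (i : ℕ) (b : Bool) :
    (F.subst i b).encode.length ≤ F.encode.length := by
  induction F with
  | const c => exact le_rfl
  | var j => by_cases h : j = i <;> simp [subst, encode, h]
  | neg F ih => simpa [subst, encode] using ih
  | conj F G ih₁ ih₂ | disj F G ih₁ ih₂ =>
    simp only [subst, encode, List.length_cons, List.length_append]
    omega

/-- With `Y` the constant `True`, the count is `#G₀ + #G₁`; the new variables add `(1 + 2 + ... + 2
^ (n - 1)) * #G₁`, so the coefficient of `#G₁` becomes `2 ^ n`. Since `G` has no variables besides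
those of `F`, one `Y` serves for the whole search. -/
theorem sharpSAT_combine (F : BoolFormula) {G : BoolFormula} {x : ℕ} (hG : G.vars ⊆ F.vars)
    (hx : x ∈ G.vars) :
    (combine G x (fresh F.encode).2).sharpSAT = (G.subst x false).sharpSAT +
      2 ^ F.encode.length * (G.subst x true).sharpSAT := by
  set n := freshBase F.encode with hn
  have hGn : ∀ i ∈ G.vars, i ≤ n := fun i hi => le_freshBase F i (hG hi)
  -- The new indices lie above `n` and are at most the stored number `m`, so `2 * m + 1` is new
  -- again.
  have key : ∀ u : List Symb,
      (u.foldr (fun _ => freshStep) (n, const true)).2.vars.card = u.length ∧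
      n ≤ (u.foldr (fun _ => freshStep) (n, const true)).1 ∧
      (∀ y ∈ (u.foldr (fun _ => freshStep) (n, const true)).2.vars,
        n < y ∧ y ≤ (u.foldr (fun _ => freshStep) (n, const true)).1) ∧
      (combine G x (u.foldr (fun _ => freshStep) (n, const true)).2).sharpSAT =
        (G.subst x false).sharpSAT + 2 ^ u.length * (G.subst x true).sharpSAT := by
    intro u
    induction u with
    | nil =>
      refine ⟨by simp [vars], le_rfl, by simp [vars], ?_⟩
      rw [List.length_nil, pow_zero, one_mul, ← sharpSAT_eq_add G hx, sharpSAT_eq_sum,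
        sharpSAT_eq_sum, vars_combine hx]
      simp [vars, combine, evalSet, eval]
    | cons a u ih =>
      rw [List.foldr_cons]
      generalize u.foldr (fun _ => freshStep) (n, const true) = p at ih
      obtain ⟨m, Y⟩ := p
      obtain ⟨h₁, h₂, h₃, h₄⟩ := ih
      simp only at h₁ h₂ h₃ h₄
      have hyY : 2 * m + 1 ∉ Y.vars := fun h => by
        have := (h₃ _ h).2
        omega
      have hyG : 2 * m + 1 ∉ G.vars := fun h => by
        have := hGn _ h
        omega
      have hvars : (conj (var (2 * m + 1)) Y).vars = insert (2 * m + 1) Y.vars := by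
        rw [vars, vars, Finset.insert_eq]
      simp only [freshStep]
      refine ⟨?_, by omega, fun y hy => ?_, ?_⟩
      · rw [hvars, Finset.card_insert_of_notMem hyY, h₁, List.length_cons]
      · rw [hvars, Finset.mem_insert] at hy
        rcases hy with rfl | hy
        · omega
        · have := h₃ y hy
          omega
      · rw [sharpSAT_combine_conj hx _ hyG hyY, h₄, h₁, List.length_cons, pow_succ]
        · ring
        · refine Finset.disjoint_left.2 fun i hi hi' => ?_
          have := hGn i hi
          have := (h₃ i hi').1
          omega
  exact (key F.encode).2.2.2

theorem firstVar_mem {F : BoolFormula} {i : ℕ} (h : F.firstVar = some i) : i ∈ F.vars := by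
  induction F with
  | const b => simp [firstVar] at h
  | var j => simpa [firstVar, vars, eq_comm] using h
  | neg F ih => exact ih h
  | conj F G ih₁ ih₂ | disj F G ih₁ ih₂ =>
    rw [firstVar, Option.or_eq_some_iff] at h
    rw [vars, Finset.mem_union]
    exact h.imp ih₁ fun h => ih₂ h.2

theorem vars_eq_empty_of_firstVar {F : BoolFormula} (h : F.firstVar = none) : F.vars = ∅ := by
  induction F with
  | const b => rfl
  | var j => simp [firstVar] at h
  | neg F ih => exact ih h
  | conj F G ih₁ ih₂ | disj F G ih₁ ih₂ =>
    rw [firstVar, Option.or_eq_none_iff] at h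
    rw [vars, ih₁ h.1, ih₂ h.2, Finset.empty_union]

end BoolFormula

end

noncomputable section

/-! ### The algorithm -/

namespace StackMachine

open BoolFormula Computability

/-- The state of the search: a formula `G`, a numeral `a`, and two numbers `s` and `t`. It claims
that the number that is searched is `s` if `a` is the number of satisfying assignments of `G`, and
`t` otherwise. -/
abbrev SearchState : Type := BoolFormula × List Bool × ℕ × ℕ

/-- The claim that a state of the search makes about the number `N`. -/
def SearchState.Claims (p : SearchState) (N : ℕ) : Prop :=
  N = if p.1.sharpSAT = binVal p.2.1 then p.2.2.1 else p.2.2.2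

/-- The next state, when `c` and `d` are two numerals, and the low and the high bits of one of them
are the numbers of satisfying assignments of the two instances of the present formula. -/
def narrow (u : List Symb) (x : ℕ) (c d : List Bool) (p : SearchState) : SearchState :=
  let cl := lowBits u c
  let ch := lowBits u (highBits u c)
  let dl := lowBits u d
  let dh := lowBits u (highBits u d)
  let bc := sumEq cl ch p.2.1
  let bd := sumEq dl dh p.2.1
  let s := bif bc then p.2.2.1 else p.2.2.2
  let t := bif bd then p.2.2.1 else p.2.2.2
  bif sumEq cl [] dl && (bc ^^ bd) then (p.1.subst x true, ch, s, t)
  else (p.1.subst x false, cl, s, bif bc ^^ bd then t else s)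

theorem claims_narrow {u : List Symb} {x : ℕ} {c d : List Bool} {p : SearchState} {N : ℕ}
    (hp : p.Claims N) (hx : x ∈ p.1.vars) (hu : p.1.vars.card ≤ u.length)
    (h : (p.1.subst x false).sharpSAT + 2 ^ u.length * (p.1.subst x true).sharpSAT = binVal c ∨
      (p.1.subst x false).sharpSAT + 2 ^ u.length * (p.1.subst x true).sharpSAT = binVal d) :
    (narrow u x c d p).Claims N := by
  obtain ⟨G, a, s, t⟩ := p
  -- An instance has lost the variable `x`, so it has fewer than `u.length` variables, and the count
  -- is strictly below the power of two.
  have hlt : ∀ b, (G.subst x b).sharpSAT < 2 ^ u.length := fun b => by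
    refine (sharpSAT_le _).trans_lt (Nat.pow_lt_pow_right (by norm_num) ?_)
    rw [vars_subst]
    exact (Finset.card_erase_lt_of_mem hx).trans_le hu
  have hsplit : ∀ e : List Bool,
      (G.subst x false).sharpSAT + 2 ^ u.length * (G.subst x true).sharpSAT = binVal e →
      binVal (lowBits u e) = (G.subst x false).sharpSAT ∧
      binVal (lowBits u (highBits u e)) = (G.subst x true).sharpSAT := by
    intro e he
    rw [binVal_lowBits, binVal_lowBits, binVal_highBits, ← he, Nat.add_mul_mod_self_left,
      Nat.add_mul_div_left _ _ (by positivity), Nat.div_eq_of_lt (hlt false), Nat.zero_add,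
      Nat.mod_eq_of_lt (hlt true), Nat.mod_eq_of_lt (hlt false)]
    exact ⟨rfl, rfl⟩
  have h' := h.imp (hsplit c) (hsplit d)
  have hsum := sharpSAT_eq_add G hx
  have sumEq_nil : ∀ l m, sumEq l [] m = decide (binVal l = binVal m) := fun l m => by
    rw [sumEq_eq]
    exact decide_eq_decide.mpr (by rw [binVal, Nat.add_zero])
  simp only [SearchState.Claims, narrow, sumEq_nil] at hp ⊢
  simp only [sumEq_eq]
  rw [hsum] at hp
  generalize hcl : binVal (lowBits u c) = cl at *
  generalize hch : binVal (lowBits u (highBits u c)) = ch at *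
  generalize hdl : binVal (lowBits u d) = dl at *
  generalize hdh : binVal (lowBits u (highBits u d)) = dh at *
  clear hsplit hlt hu h hsum
  -- The three tests become Boolean variables; each of the eight cases is linear arithmetic.
  have decide_iff : ∀ q : Prop, ∀ _ : Decidable q, ∃ b : Bool, decide q = b ∧ (b = true ↔ q) :=
    fun q _ => ⟨decide q, rfl, decide_eq_true_iff⟩
  obtain ⟨b₁, e₁, h₁⟩ := decide_iff (cl = dl) inferInstance
  obtain ⟨b₂, e₂, h₂⟩ := decide_iff (cl + ch = binVal a) inferInstance
  obtain ⟨b₃, e₃, h₃⟩ := decide_iff (dl + dh = binVal a) inferInstance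
  simp only [e₁, e₂, e₃]
  cases b₁ <;> cases b₂ <;> cases b₃ <;>
    simp only [Bool.xor_true, Bool.xor_false, Bool.not_true, Bool.not_false, Bool.and_true,
      Bool.and_false, cond_true, cond_false, hcl, hch, true_iff, false_iff, Bool.false_eq_true]
      at h₁ h₂ h₃ ⊢ <;>
    split_ifs at hp ⊢ <;> omega

/-- A step of the search, where the function `h` is asked about the formula from which the numbers
of satisfying assignments of both instances can be read off. -/
def searchStep (h : BoolFormula → ℕ × ℕ) (p : SearchState × List Symb × BoolFormula) :
    SearchState × List Symb × BoolFormula :=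
  bif p.1.1.firstVar.isSome then
    (narrow p.2.1 (p.1.1.firstVar.getD 0)
      (encodeNat (h (BoolFormula.combine p.1.1 (p.1.1.firstVar.getD 0) p.2.2)).1)
      (encodeNat (h (BoolFormula.combine p.1.1 (p.1.1.firstVar.getD 0) p.2.2)).2) p.1, p.2)
  else p

/-- The start of the search. -/
def searchStart (h : BoolFormula → ℕ × ℕ) (F : BoolFormula) :
    SearchState × List Symb × BoolFormula :=
  ((F, encodeNat (h F).1, (h F).1, (h F).2), F.encode, (fresh F.encode).2)

/-- The state of the search after as many steps as `l` has letters. -/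
def searchState (h : BoolFormula → ℕ × ℕ) (F : BoolFormula) (l : List Symb) :
    SearchState × List Symb × BoolFormula :=
  l.foldr (fun _ => searchStep h) (searchStart h F)

/-- The result of the search. -/
def searchResult (h : BoolFormula → ℕ × ℕ) (F : BoolFormula) : ℕ :=
  let p := (searchState h F F.encode).1
  bif sumEq [p.1.evalClosed] [] p.2.1 then p.2.2.1 else p.2.2.2

/-- At the start `a = s` is the first candidate, so the claim is the enumerator property. Each step
removes one variable until none is left; after that the state does not change, in accordance with
truncated subtraction. -/
theorem searchState_spec {h : BoolFormula → ℕ × ℕ}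
    (hh : ∀ F : BoolFormula, F.sharpSAT = (h F).1 ∨ F.sharpSAT = (h F).2) (F : BoolFormula)
    (l : List Symb) :
    (searchState h F l).2 = (F.encode, (fresh F.encode).2) ∧
    (searchState h F l).1.Claims F.sharpSAT ∧
    (searchState h F l).1.1.vars ⊆ F.vars ∧
    (searchState h F l).1.1.vars.card ≤ F.vars.card - l.length := by
  induction l with
  | nil =>
    refine ⟨rfl, ?_, Finset.Subset.refl _, le_rfl⟩
    simp only [searchState, searchStart, List.foldr_nil, SearchState.Claims, binVal_encodeNat]
    split_ifs with h₁
    · exact h₁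
    · exact (hh F).resolve_left h₁
  | cons a l ih =>
    have hs : searchState h F (a :: l) = searchStep h (searchState h F l) := rfl
    rw [hs]
    generalize searchState h F l = p at ih
    obtain ⟨p, u, Y⟩ := p
    obtain ⟨h₁, h₂, h₃, h₄⟩ := ih
    obtain ⟨rfl, rfl⟩ := Prod.mk.inj h₁
    simp only at h₂ h₃ h₄
    cases hv : p.1.firstVar with
    | none =>
      simp only [searchStep, hv, Option.isSome_none, cond_false]
      refine ⟨trivial, h₂, h₃, ?_⟩
      rw [vars_eq_empty_of_firstVar hv, Finset.card_empty]
      exact Nat.zero_le _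
    | some x =>
      have hx := firstVar_mem hv
      simp only [searchStep, hv, Option.isSome_some, cond_true, Option.getD_some]
      have hc := sharpSAT_combine F h₃ hx
      refine ⟨trivial, claims_narrow h₂ hx ?_ ?_, ?_, ?_⟩
      · exact (Finset.card_le_card h₃).trans (card_vars_lt F).le
      · rw [binVal_encodeNat, binVal_encodeNat, ← hc]
        exact hh _
      all_goals
        have : (narrow F.encode x
            (encodeNat (h (BoolFormula.combine p.1 x (fresh F.encode).2)).1)
            (encodeNat (h (BoolFormula.combine p.1 x (fresh F.encode).2)).2) p).1.vars = p.1.vars.erase x := by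
          unfold narrow
          simp only [Bool.cond_eq_ite]
          split_ifs <;> exact vars_subst _ _ _
        rw [this]
      · exact (Finset.erase_subset _ _).trans h₃
      · rw [Finset.card_erase_of_mem hx, List.length_cons]
        omega

theorem searchResult_eq {h : BoolFormula → ℕ × ℕ}
    (hh : ∀ F : BoolFormula, F.sharpSAT = (h F).1 ∨ F.sharpSAT = (h F).2) (F : BoolFormula) :
    searchResult h F = F.sharpSAT := by
  obtain ⟨-, h₂, -, h₄⟩ := searchState_spec hh F F.encode
  have h₅ : (searchState h F F.encode).1.1.vars = ∅ := by
    rw [← Finset.card_eq_zero]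
    have := card_vars_lt F
    omega
  rw [h₂, searchResult, sharpSAT_of_vars_eq_empty _ h₅, sumEq_eq]
  simp [binVal, Bool.cond_eq_ite]

/-- Substitution does not lengthen `G`, the numeral `a` is replaced by one cut to the length of `F`,
and the two values stay among the answers for `F` itself. Answers to later questions enter only in
truncated form, so the lengths do not compound. -/
theorem size_searchState_le (h : BoolFormula → ℕ × ℕ) (F : BoolFormula) (l : List Symb) :
    size (searchState h F l) ≤ 2 * size (searchStart h F) := by
  have key : (searchState h F l).2 = (searchStart h F).2 ∧
      (searchState h F l).1.1.encode.length ≤ F.encode.length ∧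
      (searchState h F l).1.2.1.length ≤ (encodeNat (h F).1).length + F.encode.length ∧
      ((searchState h F l).1.2.2.1 = (h F).1 ∨ (searchState h F l).1.2.2.1 = (h F).2) ∧
      ((searchState h F l).1.2.2.2 = (h F).1 ∨ (searchState h F l).1.2.2.2 = (h F).2) := by
    induction l with
    | nil => exact ⟨rfl, le_rfl, Nat.le_add_right _ _, .inl rfl, .inr rfl⟩
    | cons a l ih =>
      have hs : searchState h F (a :: l) = searchStep h (searchState h F l) := rfl
      rw [hs]
      generalize searchState h F l = p at ih
      obtain ⟨⟨G, b, s, t⟩, u, Y⟩ := p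
      obtain ⟨h₁, h₂, h₃, h₄, h₅⟩ := ih
      obtain ⟨rfl, rfl⟩ := Prod.mk.inj h₁
      simp only at h₂ h₃ h₄ h₅
      cases hv : G.firstVar with
      | none =>
        simp only [searchStep, hv, Option.isSome_none, cond_false]
        exact ⟨rfl, h₂, h₃, h₄, h₅⟩
      | some x =>
        simp only [searchStep, hv, Option.isSome_some, cond_true, Option.getD_some, narrow]
        simp only [Bool.cond_eq_ite]
        have hG := fun b => (length_encode_subst_le G x b).trans h₂
        refine ⟨rfl, ?_, ?_, ?_, ?_⟩
        · split_ifs <;> exact hG _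
        · split_ifs <;> exact (length_lowBits _ _).le.trans (Nat.le_add_left _ _)
        · split_ifs <;> assumption
        · split_ifs <;> assumption
  obtain ⟨h₁, h₂, h₃, h₄, h₅⟩ := key
  have h₄' : size (searchState h F l).1.2.2.1 ≤ size (h F).1 + size (h F).2 := by
    rcases h₄ with h₄ | h₄ <;> rw [h₄] <;> omega
  have h₅' : size (searchState h F l).1.2.2.2 ≤ size (h F).1 + size (h F).2 := by
    rcases h₅ with h₅ | h₅ <;> rw [h₅] <;> omega
  rw [size_prod, h₁]
  simp only [size_prod, size_list, size_formula, searchStart] at *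
  rw [size_nat (h F).1] at *
  omega

/-! ### The search runs in polynomial time -/

section

variable {X α : Type} [Data α]

/-- Split a string into the letters of the two kinds. -/
def splitSum (l : List (Bool ⊕ Bool)) : List Bool × List Bool :=
  l.foldr (fun x p => x.elim (fun b => (b :: p.1, p.2)) fun b => (p.1, b :: p.2)) ([], [])

theorem splitSum_append (l m : List Bool) : splitSum (l.map .inl ++ m.map .inr) = (l, m) := by
  have h : splitSum (m.map .inr) = ([], m) := by
    induction m with
    | nil => rfl
    | cons b m ih => exact congrArg (fun p : List Bool × List Bool => (p.1, b :: p.2)) ih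
  induction l with
  | nil => exact h
  | cons b l ih => exact congrArg (fun p : List Bool × List Bool => (b :: p.1, p.2)) ih

theorem PT.splitSum {f : α → List (Bool ⊕ Bool)} (hf : PT X f) :
    PT X (fun a => splitSum (f a)) := by
  refine PT.foldr_of_le (fun x => ?_) (by fun_prop) hf 1 fun x p => ?_
  · cases x <;> simp only [Sum.elim_inl, Sum.elim_inr] <;> fun_prop
  · cases x <;> simp <;> omega

theorem single_encode : (fun F : BoolFormula => single F.encode) = Data.enc := by
  funext F _
  exact List.map_id _

@[fun_prop]
theorem PT.combine {f g : α → BoolFormula} {k : α → ℕ} (hf : PT X f) (hk : PT X k)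
    (hg : PT X g) : PT X (fun a => combine (f a) (k a) (g a)) := by
  unfold BoolFormula.combine
  fun_prop

/-- The marks on the bits allow the single output string to be split into two numerals on separate
stacks. -/
theorem PT.of_encodeNatPair {h : BoolFormula → ℕ × ℕ}
    (hh : PolyTime X (fun F => single F.encode) (fun p => single (encodeNatPair p)) h) :
    PT X h := by
  rw [single_encode] at hh
  have h₁ : PT X (fun F => encodeNatPair (h F)) :=
    PolyTime.congr hh fun _ => rfl
  have h₂ := PT.splitSum h₁
  have h₃ : ∀ F, StackMachine.splitSum (encodeNatPair (h F)) =
      (Computability.encodeNat (h F).1, Computability.encodeNat (h F).2) := fun F =>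
    splitSum_append _ _
  simp only [h₃] at h₂
  exact PT.pair (PT.of_encodeNat h₂.fst) (PT.of_encodeNat h₂.snd)

theorem PT.narrow : PT X (fun p : List Symb × ℕ × List Bool × List Bool × SearchState =>
    narrow p.1 p.2.1 p.2.2.1 p.2.2.2.1 p.2.2.2.2) := by
  unfold StackMachine.narrow
  fun_prop

theorem PT.searchStep {h : BoolFormula → ℕ × ℕ} (hh : PT X h) : PT X (searchStep h) := by
  have h₁ : PT X (fun p : SearchState × List Symb × BoolFormula =>
      h (BoolFormula.combine p.1.1 (p.1.1.firstVar.getD 0) p.2.2)) := by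
    fun_prop
  have h₂ := PT.narrow.comp (f := fun p : SearchState × List Symb × BoolFormula =>
    (p.2.1, p.1.1.firstVar.getD 0,
      Computability.encodeNat (h (BoolFormula.combine p.1.1 (p.1.1.firstVar.getD 0) p.2.2)).1,
      Computability.encodeNat (h (BoolFormula.combine p.1.1 (p.1.1.firstVar.getD 0) p.2.2)).2, p.1))
    (X := X) (by fun_prop)
  exact PT.cond (by fun_prop) (PT.pair h₂ (by fun_prop)) PT.id

theorem PT.searchResult {h : BoolFormula → ℕ × ℕ} (hh : PT X h) : PT X (searchResult h) := by
  have h₁ : PT X (searchStart h) := by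
    have := PT.fresh (PT.encode (X := X) PT.id)
    unfold searchStart
    fun_prop
  have h₂ : PT X (fun F : BoolFormula => searchState h F F.encode) :=
    PT.foldr (s := fun (_ : Symb) => StackMachine.searchStep h) (fun _ => PT.searchStep hh) h₁
      (by fun_prop) (2 * Polynomial.X) fun F l _ => by
        refine (size_searchState_le h F l).trans ?_
        simp only [Polynomial.eval_mul, Polynomial.eval_X, Polynomial.eval_ofNat]
        omega
  unfold StackMachine.searchResult
  fun_prop

end

end StackMachine

end

theorem mainTheorem4 (henum : ∃ h : BoolFormula → ℕ × ℕ, IsPolyTimeTwoEnumerator h) :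
    PolyTimeComputable BoolFormula.encode Computability.encodeNat BoolFormula.sharpSAT := by
  obtain ⟨h, ⟨M⟩, hh⟩ := henum
  have h₁ := StackMachine.PT.searchResult
    (StackMachine.PT.of_encodeNatPair (StackMachine.polyTime_of_tm M))
  rw [show StackMachine.searchResult h = BoolFormula.sharpSAT from
    funext (StackMachine.searchResult_eq hh)] at h₁
  -- The additional letters are the stack letters of the machine for the enumerator.
  refine StackMachine.polyTimeComputable_of_polyTime (X := Σ k, M.tm.Γ k) ?_
  rw [StackMachine.single_encode]
  exact StackMachine.PolyTime.congr h₁ fun _ => rfl
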